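/- Let $(X,\mathcal B,\mu)$ be a standard Borel space with a nonzero, nonatomic, $\sigma$-finite measure, and let $T$ be an invertible measure-preserving transformation of $X$ (all notions, in particular invertibility, equality and disjointness of sets, are understood modulo $\mu$). A (Rokhlin) column of height $h\ge 1$ is a collection of pairwise disjoint measurable sets $B, TB,\dots,T^{h-1}B$, called its levels; $B$ is its base. A sequence of columns $(C_n)$ converges to the point partition if for every measurable $A$ with $\mu(A)<\infty$ and every $\varepsilon>0$ there is $N$ such that for all $n\ge N$ some union $B'$ of levels of $C_n$ satisfies $\mu(A\triangle B')<\varepsilon$. $T$ is rank-one if it has a sequence of columns converging to the point partition. A cutting and stacking presentation of $T$ is a sequence of columns $(C_n)_{n\ge 0}$ of $T$, with bases $B_n$ and heights $h_n$, converging to the point partition, together with integers $r_n\ge 2$ and $s_{n,k}\ge 0$ such that $h_0=1$, $0<\mu(B_0)<\infty$, and for every $n\ge 0$ $$h_{n+1}=\sum_{k=0}^{r_n-1}(h_n+s_{n,k}),\qquad B_n=\bigcup_{i=0}^{r_n-1}T^{p_{n,i}}B_{n+1},\quad p_{n,i}=\sum_{k=0}^{i-1}(h_n+s_{n,k}).$$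 **Theorem.** Let $T$ be a rank-one transformation. Then $T$ has a cutting and stacking presentation. Moreover, for every cutting and stacking presentation $(C_n)$ of $T$, with $I=B_0$ the level of $C_0$, and for all finite unions $A,B$ of levels (of any of the columns $C_n$), $$\frac{1}{a_n(I)}\sum_{k=0}^{n-1}\mu(A\cap T^kB)\longrightarrow\mu(A)\mu(B)\quad(n\to\infty),\qquad\text{where } a_n(I)=\sum_{k=0}^{n-1}\frac{\mu(I\cap T^kI)}{\mu(I)^2}.$$ (Normality, i.e. $s_{n,r_n-1}>0$ for infinitely many $n$, is not assumed.) -/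

import Mathlib

open MeasureTheory Filter Topology

/-- An invertible measure-preserving transformation of `(X, μ)`. Invertibility is understood
modulo `μ`: `invFun` is a measurable inverse of `toFun` almost everywhere. -/
structure InvertibleMPT {X : Type*} [MeasurableSpace X] (μ : Measure X) where
  toFun : X → X
  invFun : X → X
  measurePreserving_toFun : MeasurePreserving toFun μ μ
  measurePreserving_invFun : MeasurePreserving invFun μ μ
  left_inv : ∀ᵐ x ∂μ, invFun (toFun x) = x
  right_inv : ∀ᵐ x ∂μ, toFun (invFun x) = x

namespace InvertibleMPT

variable {X : Type*} [MeasurableSpace X] {μ : Measure X}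

/-- The set `T ^ k B`, for `k ≥ 0`, as the preimage of `B` under the `k`-th iterate of the inverse.
If `T` is a genuine bijection with inverse `invFun`, this is the image of `B` under `T ^ k`;
in general it is the version of that image which does not depend, up to a null set, on the choice
of `T` in its almost everywhere class. -/
def iterImage (T : InvertibleMPT μ) (k : ℕ) (B : Set X) : Set X :=
  T.invFun^[k] ⁻¹' B

/-- The intrinsic weight `u_k(F) = μ (F ∩ T ^ k F) / μ(F) ^ 2`. -/
noncomputable def weight (T : InvertibleMPT μ) (F : Set X) (k : ℕ) : ℝ :=
  μ.real (F ∩ T.iterImage k F) / μ.real F ^ 2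

/-- `a_n(F) = u_0(F) + ⋯ + u_{n-1}(F)`. -/
noncomputable def weightSum (T : InvertibleMPT μ) (F : Set X) (n : ℕ) : ℝ :=
  ∑ k ∈ Finset.range n, T.weight F k

/-- The limit in the definition of weak rational ergodicity, for the set `F` and the pair `A`, `B`:
`(1 / a_n(F)) * ∑_{k < n} μ (A ∩ T ^ k B) → μ(A) μ(B)`. -/
def WeakRationalLimit (T : InvertibleMPT μ) (F A B : Set X) : Prop :=
  Tendsto
    (fun n : ℕ => 1 / T.weightSum F n * ∑ k ∈ Finset.range n, μ.real (A ∩ T.iterImage k B))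
    atTop (𝓝 (μ.real A * μ.real B))

/-- A Rokhlin column for `T`: a measurable base `B` and a height `h ≥ 1` such that
`B, T B, …, T ^ (h - 1) B` are pairwise disjoint (modulo `μ`). -/
structure Column (T : InvertibleMPT μ) where
  base : Set X
  height : ℕ
  height_pos : 0 < height
  measurableSet_base : MeasurableSet base
  aedisjoint : ∀ i < height, ∀ j < height, i ≠ j →
    AEDisjoint μ (T.iterImage i base) (T.iterImage j base)

/-- The set `T ^ i B`; it is a level of the column when `i < height`. -/
def Column.level {T : InvertibleMPT μ} (C : T.Column) (i : ℕ) : Set X :=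
  T.iterImage i C.base

/-- The columns `C n` converge to the point partition: every measurable set of finite measure is
approximated in measure, for all large `n`, by unions of levels of `C n`. -/
def ConvergesToPoints {T : InvertibleMPT μ} (C : ℕ → T.Column) : Prop :=
  ∀ A : Set X, MeasurableSet A → μ A ≠ ⊤ → ∀ ε : ENNReal, 0 < ε →
    ∃ N : ℕ, ∀ n ≥ N, ∃ E ⊆ Finset.range (C n).height,
      μ (symmDiff A (⋃ i ∈ E, (C n).level i)) < ε

/-- `T` is rank-one. -/
def IsRankOne (T : InvertibleMPT μ) : Prop :=
  ∃ C : ℕ → T.Column, ConvergesToPoints C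

/-- The columns `C n` present `T` as a cutting and stacking construction. `C 0` is a single level of
positive finite measure. The column `C n` is cut into `r n ≥ 2` subcolumns, `s n k` spacers are put
above the `k`-th one, and `C (n + 1)` is the resulting stack, so that the base of the `i`-th
subcolumn of `C n` is the level of `C (n + 1)` at height `∑_{k < i} (h_n + s n k)`. -/
structure IsCuttingAndStacking {T : InvertibleMPT μ} (C : ℕ → T.Column)
    (r : ℕ → ℕ) (s : ℕ → ℕ → ℕ) : Prop where
  height_zero : (C 0).height = 1
  measure_base_zero_pos : 0 < μ (C 0).base
  measure_base_zero_ne_top : μ (C 0).base ≠ ⊤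
  two_le_cuts : ∀ n, 2 ≤ r n
  height_succ : ∀ n, (C (n + 1)).height = ∑ k ∈ Finset.range (r n), ((C n).height + s n k)
  base_eq : ∀ n, (C n).base =ᵐ[μ]
    ⋃ i ∈ Finset.range (r n), (C (n + 1)).level (∑ k ∈ Finset.range i, ((C n).height + s n k))
  converges : ConvergesToPoints C

/-- `A` is a finite union of levels, possibly from different columns of the sequence. -/
def IsFiniteUnionOfLevels {T : InvertibleMPT μ} (C : ℕ → T.Column) (A : Set X) : Prop :=
  ∃ L : Finset (ℕ × ℕ), (∀ p ∈ L, p.2 < (C p.1).height) ∧ A = ⋃ p ∈ L, (C p.1).level p.2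

end InvertibleMPT

/-! The limit for a given presentation needs only one column at a time. By refinement, `A`, `B` and
`I` are, modulo `μ`, unions of `a`, `b` and `c` levels of a common column `C N`. Expanding over
pairs of levels turns `∑_{k<n} μ(A ∩ T^k B)` into `a * b` sums of base correlations `μ(B_N ∩ T^(k+d)
B_N)`. A fixed translation by `d` changes such a sum by a bounded amount, so the total is `a * b *
y_n + O(1)`, where `y_n` is the sum for the base itself (`exists_abs_sum_measureReal_sub_le`). The
sums for `I` diverge (`IsCuttingAndStacking.tendsto_sum_measureReal`), hence so does `y_n`, and the
normalized ratio tends to `μ(I)^2 * a * b / c^2 = μ(A) μ(B)`.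

For existence, a column of a rank-one sequence that approximates the base `E` of an earlier tower
very well has many levels lying mostly in `E`. Two such levels cannot be too close, since they would
force `E` to overlap a translate that is disjoint from it. They therefore mark disjoint copies of
the earlier tower, up to a small error (`Tower.exists_copies`). The part below the first copy has to
be discarded; conservativity and ergodicity, obtained from the same overlap argument, show that it
carries little of any prescribed set of finite measure. This gives almost nested towers with
summable errors (`Tower.exists_almost_nested_towers`). Rebuilding each base from those of later
towers and passing to the limit makes the nesting exact modulo `μ` (`Tower.limitBase_ae_eq`), while
the summable errors preserve convergence and a positive initial base. -/

/-- In a nonatomic measure on a standard Borel space, sets of positive measure have subsets of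
arbitrarily small positive measure. -/
theorem exists_measure_pos_lt {X : Type*} [MeasurableSpace X] [StandardBorelSpace X]
    (μ : Measure X) [SigmaFinite μ] [NullSingletonClass μ] (hμ : μ ≠ 0) {δ : ENNReal}
    (hδ : 0 < δ) : ∃ A, MeasurableSet A ∧ 0 < μ A ∧ μ A < δ := by
  by_contra! hcon
  let _ := upgradeStandardBorel X
  obtain ⟨A, hAm, -, hA0, hAtop⟩ := Measure.exists_subset_measure_lt_top (μ := μ)
    MeasurableSet.univ (r := 0) (by simpa [pos_iff_ne_zero] using hμ)
  have hfin : IsFiniteMeasure (μ.restrict A) := ⟨by simpa using hAtop⟩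
  -- Points are null, so by outer regularity each has a neighbourhood meeting `A` in measure below
  -- `δ`, hence in a null set; `A` is then locally null, hence null.
  have key : (μ.restrict A) Set.univ = 0 := by
    refine measure_null_of_locally_null _ fun x _ => ?_
    obtain ⟨U, hxU, hU, hUlt⟩ := Set.exists_isOpen_lt_of_lt {x} δ
      (μ := μ.restrict A) (by
        refine lt_of_le_of_lt (Measure.restrict_apply_le A {x}) ?_
        simpa using hδ)
    refine ⟨U, mem_nhdsWithin_of_mem_nhds (hU.mem_nhds (hxU rfl)), ?_⟩
    rw [Measure.restrict_apply hU.measurableSet] at hUlt ⊢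
    by_contra h0
    exact absurd hUlt (not_lt.2 (hcon _ (hU.measurableSet.inter hAm) (pos_iff_ne_zero.2 h0)))
  simp at key
  exact hA0.ne' key

namespace InvertibleMPT

/-! ### Action of the powers of a bijection on sets. -/

section Shift

variable {X : Type*}

/-- The image of `B` under the power `e ^ k`, `k : ℤ`, of a bijection. -/
def shift (e : Equiv.Perm X) (k : ℤ) (B : Set X) : Set X := {x | (e ^ (-k)) x ∈ B}

variable (e : Equiv.Perm X) (j k : ℤ) (A B : Set X)

theorem mem_shift {x : X} : x ∈ shift e k B ↔ (e ^ (-k)) x ∈ B := Iff.rfl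

@[simp] theorem shift_zero : shift e 0 B = B := by ext; simp [mem_shift]

@[simp] theorem shift_shift : shift e j (shift e k B) = shift e (j + k) B := by
  ext x
  rw [mem_shift, mem_shift, mem_shift, ← Equiv.Perm.mul_apply, ← zpow_add, neg_add_rev]

theorem shift_inter : shift e k (A ∩ B) = shift e k A ∩ shift e k B := rfl

theorem shift_diff : shift e k (A \ B) = shift e k A \ shift e k B := rfl

theorem shift_symmDiff : shift e k (symmDiff A B) = symmDiff (shift e k A) (shift e k B) := rfl

theorem shift_iUnion {ι : Sort*} (s : ι → Set X) :
    shift e k (⋃ i, s i) = ⋃ i, shift e k (s i) := by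
  ext; simp [mem_shift]

variable {A B} in
theorem shift_mono (h : A ⊆ B) : shift e k A ⊆ shift e k B := fun _ hx => h hx

variable [MeasurableSpace X] {μ : Measure X} {e} (he : ∀ k : ℤ, MeasurePreserving (e ^ k) μ μ)

include he

theorem measurableSet_shift {B : Set X} (hB : MeasurableSet B) : MeasurableSet (shift e k B) :=
  (he (-k)).measurable hB

/-- Packaging the power as a measurable equivalence gives the equality for arbitrary sets,
measurable or not. -/
theorem measure_shift : μ (shift e k B) = μ B := by
  let f : X ≃ᵐ X :=
    { toEquiv := e ^ (-k)
      measurable_toFun := (he (-k)).measurable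
      measurable_invFun := by
        have := (he k).measurable
        rw [zpow_neg]
        exact this }
  exact MeasurePreserving.measure_preimage_equiv (f := f) (he (-k)) B

theorem shift_ae_eq {A B : Set X} (h : A =ᵐ[μ] B) : shift e k A =ᵐ[μ] shift e k B := by
  rw [← measure_symmDiff_eq_zero_iff] at h ⊢
  rw [← shift_symmDiff, measure_shift k _ he, h]

theorem measure_shift_inter_shift : μ (shift e j A ∩ shift e k B) = μ (A ∩ shift e (k - j) B) := by
  rw [← measure_shift (-j) _ he, shift_inter, shift_shift, shift_shift]
  simp [sub_eq_neg_add]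

end Shift

variable {X : Type*} [MeasurableSpace X] {μ : Measure X}

/-- An almost everywhere invertible transformation agrees almost everywhere with a bijection. -/
theorem exists_perm [StandardBorelSpace X] (T : InvertibleMPT μ) :
    ∃ e : Equiv.Perm X, (∀ k : ℤ, MeasurePreserving (e ^ k) μ μ) ∧
      ∀ (k : ℕ) (B : Set X), T.iterImage k B =ᵐ[μ] shift e k B := by
  classical
  obtain ⟨f, g, hf, hg, hgf, hfg⟩ := T
  -- `S` is conull and stable under `f` and `g`, which are mutually inverse on it; the bijection
  -- follows `f` on `S` and is the identity elsewhere.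
  let S : Set X := {x | ∀ k : ℕ, f (g (g^[k] x)) = g^[k] x ∧ g (f (f^[k] x)) = f^[k] x}
  have hS : MeasurableSet S := by
    have h : S = ⋂ k : ℕ, ({x | f (g (g^[k] x)) = g^[k] x} ∩ {x | g (f (f^[k] x)) = f^[k] x}) := by
      ext; simp [S]
    rw [h]
    let _ := upgradeStandardBorel X
    refine MeasurableSet.iInter fun k => MeasurableSet.inter ?_ ?_
    · exact measurableSet_eq_fun (hf.measurable.comp (hg.measurable.comp (hg.measurable.iterate k)))
        (hg.measurable.iterate k)
    · exact measurableSet_eq_fun (hg.measurable.comp (hf.measurable.comp (hf.measurable.iterate k)))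
        (hf.measurable.iterate k)
  have hSae : ∀ᵐ x ∂μ, x ∈ S := by
    refine ae_all_iff.2 fun k => ?_
    exact ((hg.iterate k).quasiMeasurePreserving.ae hfg).and
      ((hf.iterate k).quasiMeasurePreserving.ae hgf)
  have hgfS : ∀ x ∈ S, g (f x) = x := fun x hx => (hx 0).2
  have hfgS : ∀ x ∈ S, f (g x) = x := fun x hx => (hx 0).1
  have hfS : ∀ x ∈ S, f x ∈ S := by
    intro x hx k
    refine ⟨?_, by simpa using (hx (k + 1)).2⟩
    cases k with
    | zero => simp [hgfS x hx]
    | succ k => simpa [Function.iterate_succ_apply, hgfS x hx] using (hx k).1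
  have hgS : ∀ x ∈ S, g x ∈ S := by
    intro x hx k
    refine ⟨by simpa using (hx (k + 1)).1, ?_⟩
    cases k with
    | zero => simp [hfgS x hx]
    | succ k => simpa [Function.iterate_succ_apply, hfgS x hx] using (hx k).2
  let e : Equiv.Perm X :=
    { toFun := fun x => if x ∈ S then f x else x
      invFun := fun x => if x ∈ S then g x else x
      left_inv := by
        intro x
        by_cases hx : x ∈ S <;> simp [hx, hfS, hgfS]
      right_inv := by
        intro x
        by_cases hx : x ∈ S <;> simp [hx, hgS, hfgS] }
  have hef : ∀ x ∈ S, e x = f x := fun x hx => if_pos hx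
  have heg : ∀ x ∈ S, e.symm x = g x := fun x hx => if_pos hx
  have hemp : MeasurePreserving e μ μ := by
    refine ⟨Measurable.ite hS hf.measurable measurable_id, ?_⟩
    rw [← hf.map_eq]
    refine Eq.symm ?_
    rw [hf.map_eq]
    conv_lhs => rw [← hf.map_eq]
    exact Measure.map_congr (hSae.mono fun x hx => (hef x hx).symm)
  have hemp' : MeasurePreserving e.symm μ μ := by
    refine ⟨Measurable.ite hS hg.measurable measurable_id, ?_⟩
    conv_rhs => rw [← hg.map_eq]
    exact Measure.map_congr (hSae.mono fun x hx => heg x hx)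
  refine ⟨e, ?_, ?_⟩
  · intro k
    obtain ⟨n, rfl | rfl⟩ := k.eq_nat_or_neg
    · rw [zpow_natCast, Equiv.Perm.coe_pow]
      exact hemp.iterate n
    · rw [zpow_neg, zpow_natCast, ← inv_pow, Equiv.Perm.coe_pow]
      exact hemp'.iterate n
  · intro k B
    have hit : ∀ (k : ℕ), ∀ x ∈ S, g^[k] x = (e.symm)^[k] x := by
      intro k
      induction k with
      | zero => simp
      | succ k ih =>
        intro x hx
        rw [Function.iterate_succ_apply, Function.iterate_succ_apply, heg x hx, ih _ (hgS x hx)]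
    filter_upwards [hSae] with x hx
    refine propext ?_
    change g^[k] x ∈ B ↔ (e ^ (-(k : ℤ))) x ∈ B
    rw [hit k x hx, zpow_neg, zpow_natCast, ← inv_pow, Equiv.Perm.coe_pow]
    rfl

end InvertibleMPT

namespace InvertibleMPT

theorem biUnion_ae_eq {X : Type*} [MeasurableSpace X] {μ : Measure X} {ι : Type*} (S : Finset ι)
    {A B : ι → Set X} (h : ∀ i, A i =ᵐ[μ] B i) :
    (⋃ i ∈ S, A i : Set X) =ᵐ[μ] (⋃ i ∈ S, B i : Set X) :=
  Filter.EventuallyEq.countable_bUnion S.countable_toSet fun i _ => h i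

/-! ### Correlations between unions of levels of one column. -/

section UnionsOfTranslates

variable {X : Type*} [MeasurableSpace X] {μ : Measure X} {e : Equiv.Perm X}
  (he : ∀ k : ℤ, MeasurePreserving (e ^ k) μ μ) {b : Set X} {h : ℕ}
  (hbm : MeasurableSet b) (hb : μ b ≠ ⊤)
  (hdisj : ∀ i < h, ∀ j < h, i ≠ j → AEDisjoint μ (shift e i b) (shift e j b))

include he hbm hb hdisj

theorem measureReal_eq_card_mul {A : Set X} {S : Finset ℕ} (hS : S ⊆ Finset.range h)
    (hA : A =ᵐ[μ] ⋃ i ∈ S, shift e i b) : μ.real A = S.card * μ.real b := by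
  rw [measureReal_congr hA, measureReal_biUnion_finset₀
    (h := fun i _ => by rwa [measure_shift _ _ he])]
  · simp [measureReal_def, measure_shift _ _ he]
  · intro i hi j hj hij
    exact hdisj i (by simpa using hS hi) j (by simpa using hS hj) hij
  · exact fun i _ => (measurableSet_shift _ he hbm).nullMeasurableSet

theorem measureReal_inter_shift {A B : Set X} {S S' : Finset ℕ} (hS : S ⊆ Finset.range h)
    (hS' : S' ⊆ Finset.range h) (hA : A =ᵐ[μ] ⋃ i ∈ S, shift e i b)
    (hB : B =ᵐ[μ] ⋃ i ∈ S', shift e i b) (k : ℤ) :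
    μ.real (A ∩ shift e k B) =
      ∑ p ∈ S ×ˢ S', μ.real (b ∩ shift e (k + ((p.2 : ℤ) - p.1)) b) := by
  have h1 : (A ∩ shift e k B : Set X) =ᵐ[μ]
      ⋃ p ∈ S ×ˢ S', (shift e p.1 b ∩ shift e k (shift e p.2 b) : Set X) := by
    refine (hA.inter (shift_ae_eq k he hB)).trans (Eq.eventuallyEq ?_)
    refine Set.ext fun x => ?_
    simp only [shift_iUnion, Set.mem_inter_iff, Set.mem_iUnion, Finset.mem_product, Prod.exists,
      exists_prop]
    constructor
    · rintro ⟨⟨i, hi, hx⟩, j, hj, hy⟩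
      exact ⟨i, j, ⟨hi, hj⟩, hx, hy⟩
    · rintro ⟨i, j, ⟨hi, hj⟩, hx, hy⟩
      exact ⟨⟨i, hi, hx⟩, j, hj, hy⟩
  rw [measureReal_congr h1, measureReal_biUnion_finset₀
    (h := fun p _ => ne_top_of_le_ne_top (by rwa [measure_shift _ _ he])
      (measure_mono Set.inter_subset_left))]
  · refine Finset.sum_congr rfl fun p _ => ?_
    rw [measureReal_def, shift_shift, measure_shift_inter_shift _ _ _ _ he, add_sub_assoc,
      measureReal_def]
  · rintro ⟨i, j⟩ hp ⟨i', j'⟩ hp' hne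
    simp only [Finset.coe_product, Set.mem_prod, Finset.mem_coe] at hp hp'
    by_cases hii : i = i'
    · have hjj : j ≠ j' := fun hjj => hne (by rw [hii, hjj])
      have := hdisj j (by simpa using hS' hp.2) j' (by simpa using hS' hp'.2) hjj
      have h2 : AEDisjoint μ (shift e k (shift e j b)) (shift e k (shift e j' b)) := by
        rw [AEDisjoint, ← shift_inter, measure_shift _ _ he]
        exact this
      exact h2.mono Set.inter_subset_right Set.inter_subset_right
    · exact (hdisj i (by simpa using hS hp.1) i' (by simpa using hS hp'.1) hii).mono
        Set.inter_subset_left Set.inter_subset_left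
  · exact fun p _ => ((measurableSet_shift _ he hbm).inter
      (measurableSet_shift _ he (measurableSet_shift _ he hbm))).nullMeasurableSet

/-- At least half of the pairs `p` in `S ×ˢ S` satisfy `p.2 ≤ p.1`, and each of these contributes a
full `μ(b)` at time `k = p.1 - p.2 < h`. This quadratic growth is the source of the divergence of
`a_n(I)`. -/
theorem card_sq_mul_le_sum_measureReal {A : Set X} {S : Finset ℕ} (hS : S ⊆ Finset.range h)
    (hA : A =ᵐ[μ] ⋃ i ∈ S, shift e i b) :
    (S.card : ℝ) ^ 2 / 2 * μ.real b ≤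
      ∑ k ∈ Finset.range h, μ.real (A ∩ shift e (k : ℤ) A) := by
  simp_rw [measureReal_inter_shift he hbm hb hdisj hS hS hA hA]
  rw [Finset.sum_comm]
  let D := (S ×ˢ S).filter fun p => p.2 ≤ p.1
  let D' := (S ×ˢ S).filter fun p => p.1 ≤ p.2
  have hcard : D.card = D'.card := by
    refine Finset.card_bij (fun p _ => p.swap) ?_ ?_ ?_
    · intro p hp
      simp only [D, D', Finset.mem_filter, Finset.mem_product, Prod.fst_swap, Prod.snd_swap] at hp ⊢
      tauto
    · intro p _ q _ hpq
      exact Prod.swap_injective hpq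
    · intro p hp
      refine ⟨p.swap, ?_, Prod.swap_swap p⟩
      simp only [D, D', Finset.mem_filter, Finset.mem_product, Prod.fst_swap, Prod.snd_swap] at hp ⊢
      tauto
  have hunion : D ∪ D' = S ×ˢ S := by
    ext p
    simp only [D, D', Finset.mem_union, Finset.mem_filter]
    have := le_total p.1 p.2
    tauto
  have h2 : S.card ^ 2 ≤ 2 * D.card := by
    have := Finset.card_union_le D D'
    rw [hunion, Finset.card_product] at this
    rw [sq]
    omega
  have h2' : (S.card : ℝ) ^ 2 ≤ 2 * D.card := by exact_mod_cast h2
  calc (S.card : ℝ) ^ 2 / 2 * μ.real b ≤ D.card * μ.real b := by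
        gcongr
        linarith
    _ = ∑ p ∈ D, μ.real b := by simp
    _ ≤ ∑ p ∈ D, ∑ k ∈ Finset.range h, μ.real (b ∩ shift e (k + ((p.2 : ℤ) - p.1)) b) := by
        refine Finset.sum_le_sum fun p hp => ?_
        simp only [D, Finset.mem_filter, Finset.mem_product] at hp
        have hk : p.1 - p.2 ∈ Finset.range h := by
          have := hS hp.1.1
          simp only [Finset.mem_range] at this ⊢
          omega
        refine le_trans ?_ (Finset.single_le_sum (fun _ _ => measureReal_nonneg) hk)
        have : ((p.1 - p.2 : ℕ) : ℤ) + ((p.2 : ℤ) - p.1) = 0 := by omega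
        simp [this]
    _ ≤ _ := Finset.sum_le_sum_of_subset_of_nonneg (Finset.filter_subset _ _)
        fun _ _ _ => Finset.sum_nonneg fun _ _ => measureReal_nonneg

end UnionsOfTranslates

/-- Translating by one adds one term and drops another, so the sum moves by at most `M`; induction
on `c` in both directions does the rest. -/
theorem exists_abs_sum_range_translate_sub_le (φ : ℤ → ℝ) (M : ℝ) (h0 : ∀ k, 0 ≤ φ k)
    (hM : ∀ k, φ k ≤ M) (c : ℤ) :
    ∃ K, ∀ n : ℕ,
      |∑ k ∈ Finset.range n, φ (k + c) - ∑ k ∈ Finset.range n, φ k| ≤ K := by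
  have step : ∀ (c : ℤ) (n : ℕ),
      |∑ k ∈ Finset.range n, φ (k + (c + 1)) - ∑ k ∈ Finset.range n, φ (k + c)| ≤ M := by
    intro c n
    have h := Finset.sum_range_succ' (fun k : ℕ => φ (k + c)) n
    rw [Finset.sum_range_succ] at h
    have h' : ∑ k ∈ Finset.range n, φ (k + (c + 1)) =
        ∑ k ∈ Finset.range n, φ ((k + 1 : ℕ) + c) := by
      refine Finset.sum_congr rfl fun k _ => ?_
      congr 1
      push_cast
      ring
    rw [h', abs_le]
    have h1 := h0 (n + c)
    have h2 := hM (n + c)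
    have h3 := h0 ((0 : ℕ) + c)
    have h4 := hM ((0 : ℕ) + c)
    constructor <;> linarith
  induction c using Int.induction_on with
  | zero => exact ⟨0, by simp⟩
  | succ c ih =>
    obtain ⟨K, hK⟩ := ih
    refine ⟨M + K, fun n => ?_⟩
    have := abs_add_le (∑ k ∈ Finset.range n, φ (k + ((c : ℤ) + 1))
      - ∑ k ∈ Finset.range n, φ (k + c))
      (∑ k ∈ Finset.range n, φ (k + c) - ∑ k ∈ Finset.range n, φ k)
    rw [sub_add_sub_cancel] at this
    linarith [hK n, step c n]
  | pred c ih =>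
    obtain ⟨K, hK⟩ := ih
    refine ⟨M + K, fun n => ?_⟩
    have h1 := step (-(c : ℤ) - 1) n
    rw [abs_sub_comm, sub_add_cancel] at h1
    have := abs_add_le (∑ k ∈ Finset.range n, φ (k + (-(c : ℤ) - 1))
      - ∑ k ∈ Finset.range n, φ (k + -(c : ℤ)))
      (∑ k ∈ Finset.range n, φ (k + -(c : ℤ)) - ∑ k ∈ Finset.range n, φ k)
    rw [sub_add_sub_cancel] at this
    linarith [hK n]

/-- Correlation sums of unions of levels of one column are proportional, up to a bounded error. -/
theorem exists_abs_sum_measureReal_sub_le {X : Type*} [MeasurableSpace X] {μ : Measure X}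
    {e : Equiv.Perm X} (he : ∀ k : ℤ, MeasurePreserving (e ^ k) μ μ) {b : Set X} {h : ℕ}
    (hbm : MeasurableSet b) (hb : μ b ≠ ⊤)
    (hdisj : ∀ i < h, ∀ j < h, i ≠ j → AEDisjoint μ (shift e i b) (shift e j b))
    {A B : Set X} {S S' : Finset ℕ} (hS : S ⊆ Finset.range h)
    (hS' : S' ⊆ Finset.range h) (hA : A =ᵐ[μ] ⋃ i ∈ S, shift e i b)
    (hB : B =ᵐ[μ] ⋃ i ∈ S', shift e i b) :
    ∃ K, ∀ n : ℕ, |∑ k ∈ Finset.range n, μ.real (A ∩ shift e (k : ℤ) B) -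
      S.card * S'.card * ∑ k ∈ Finset.range n, μ.real (b ∩ shift e (k : ℤ) b)| ≤ K := by
  have key := exists_abs_sum_range_translate_sub_le (fun k => μ.real (b ∩ shift e k b)) (μ.real b)
    (fun _ => measureReal_nonneg) (fun _ => measureReal_mono Set.inter_subset_left hb)
  choose K hK using key
  refine ⟨∑ p ∈ S ×ˢ S', K ((p.2 : ℤ) - p.1), fun n => ?_⟩
  simp_rw [measureReal_inter_shift he hbm hb hdisj hS hS' hA hB]
  rw [Finset.sum_comm]
  have : (S.card : ℝ) * S'.card * ∑ k ∈ Finset.range n, μ.real (b ∩ shift e (k : ℤ) b) =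
      ∑ p ∈ S ×ˢ S', ∑ k ∈ Finset.range n, μ.real (b ∩ shift e (k : ℤ) b) := by
    simp [Finset.card_product]
  rw [this, ← Finset.sum_sub_distrib]
  exact (Finset.abs_sum_le_sum_abs _ _).trans (Finset.sum_le_sum fun p _ => hK _ n)

theorem tendsto_div_of_abs_sub_mul_le {x y : ℕ → ℝ} {c K : ℝ} (hy : Tendsto y atTop atTop)
    (h : ∀ n, |x n - c * y n| ≤ K) : Tendsto (fun n => x n / y n) atTop (𝓝 c) := by
  rw [tendsto_iff_norm_sub_tendsto_zero]
  refine squeeze_zero' (Eventually.of_forall fun _ => norm_nonneg _) ?_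
    (Tendsto.div_atTop (tendsto_const_nhds (x := K)) hy)
  filter_upwards [hy.eventually_gt_atTop 0] with n hn
  rw [Real.norm_eq_abs, div_sub' hn.ne', abs_div, abs_of_pos hn, mul_comm (y n)]
  gcongr
  exact h n

/-! ### The weak rational limit for a given presentation. -/

section Presentation

variable {X : Type*} [MeasurableSpace X] {μ : Measure X} {T : InvertibleMPT μ}
  {e : Equiv.Perm X} (he : ∀ k : ℤ, MeasurePreserving (e ^ k) μ μ)
  (hTe : ∀ (k : ℕ) (B : Set X), T.iterImage k B =ᵐ[μ] shift e k B)

include hTe in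
theorem Column.aedisjoint_shift (C : T.Column) : ∀ i < C.height, ∀ j < C.height, i ≠ j →
    AEDisjoint μ (shift e i C.base) (shift e j C.base) :=
  fun i hi j hj hij => (C.aedisjoint i hi j hj hij).congr (hTe i _).symm (hTe j _).symm

variable {C : ℕ → T.Column} {r : ℕ → ℕ} {s : ℕ → ℕ → ℕ} (hC : IsCuttingAndStacking C r s)

theorem Column.offset_strictMono (C : T.Column) (s : ℕ → ℕ) :
    StrictMono fun i => ∑ k ∈ Finset.range i, (C.height + s k) := by
  refine strictMono_nat_of_lt_succ fun i => ?_
  rw [Finset.sum_range_succ]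
  have := C.height_pos
  omega

include hC

theorem IsCuttingAndStacking.offset_add_height_le {n i : ℕ} (hi : i < r n) :
    ∑ k ∈ Finset.range i, ((C n).height + s n k) + (C n).height ≤ (C (n + 1)).height := by
  have h1 : ∑ k ∈ Finset.range (i + 1), ((C n).height + s n k) ≤
      ∑ k ∈ Finset.range (r n), ((C n).height + s n k) :=
    Finset.sum_le_sum_of_subset (by simpa using hi)
  rw [Finset.sum_range_succ] at h1
  rw [hC.height_succ n]
  omega

/-- The base of `C n` is a union of at least two levels of `C (n + 1)`. -/
theorem IsCuttingAndStacking.exists_offsets (n : ℕ) : ∃ P : Finset ℕ, 2 ≤ P.card ∧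
    (∀ j ∈ P, j + (C n).height ≤ (C (n + 1)).height) ∧
    (C n).base =ᵐ[μ] ⋃ j ∈ P, (C (n + 1)).level j := by
  refine ⟨(Finset.range (r n)).map ⟨_, ((C n).offset_strictMono (s n)).injective⟩, ?_, ?_, ?_⟩
  · simpa using hC.two_le_cuts n
  · intro j hj
    obtain ⟨i, hi, rfl⟩ := Finset.mem_map.1 hj
    exact hC.offset_add_height_le (Finset.mem_range.1 hi)
  · refine (hC.base_eq n).trans (Eq.eventuallyEq ?_)
    refine Set.ext fun x => ?_
    simp

include he hTe in
theorem IsCuttingAndStacking.exists_level_eq {n N : ℕ} (hnN : n ≤ N) {i : ℕ}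
    (hi : i < (C n).height) : ∃ S ⊆ Finset.range (C N).height,
      (C n).level i =ᵐ[μ] ⋃ j ∈ S, shift e j (C N).base := by
  induction N, hnN using Nat.le_induction with
  | base => exact ⟨{i}, by simpa using hi, by simpa [Column.level] using hTe i (C n).base⟩
  | succ N _ ih =>
    classical
    obtain ⟨S, hS, hSeq⟩ := ih
    obtain ⟨P, -, hP, hPeq⟩ := hC.exists_offsets N
    have hPeq' : (C N).base =ᵐ[μ] ⋃ j ∈ P, shift e j (C (N + 1)).base :=
      hPeq.trans (biUnion_ae_eq _ fun j => hTe j _)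
    -- Each index `a` is replaced by the indices `a + p`, one for each copy of `C N`; they stay
    -- below the new height because a whole copy fits above `p`.
    refine ⟨Finset.image₂ (· + ·) S P, ?_, ?_⟩
    · intro m hm
      obtain ⟨a, ha, p, hp, rfl⟩ := Finset.mem_image₂.1 hm
      have h1 := hP p hp
      have h2 := Finset.mem_range.1 (hS ha)
      rw [Finset.mem_range]
      omega
    · refine hSeq.trans ((biUnion_ae_eq S
        fun j => shift_ae_eq (j : ℤ) he hPeq').trans (Eq.eventuallyEq ?_))
      refine Set.ext fun x => ?_
      simp only [shift_iUnion, shift_shift, Set.mem_iUnion, Finset.mem_image₂, exists_prop]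
      constructor
      · rintro ⟨a, ha, p, hp, hx⟩
        exact ⟨a + p, ⟨a, ha, p, hp, rfl⟩, by exact_mod_cast hx⟩
      · rintro ⟨_, ⟨a, ha, p, hp, rfl⟩, hx⟩
        exact ⟨a, ha, p, hp, by exact_mod_cast hx⟩

include he hTe in
theorem IsCuttingAndStacking.exists_union_eq {A : Set X} (hA : IsFiniteUnionOfLevels C A) :
    ∃ n, ∀ N ≥ n, ∃ S ⊆ Finset.range (C N).height, A =ᵐ[μ] ⋃ j ∈ S, shift e j (C N).base := by
  classical
  obtain ⟨L, hL, rfl⟩ := hA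
  refine ⟨L.sup Prod.fst, fun N hN => ?_⟩
  have h : ∀ p : ℕ × ℕ, ∃ S ⊆ Finset.range (C N).height, p ∈ L →
      (C p.1).level p.2 =ᵐ[μ] ⋃ j ∈ S, shift e j (C N).base := by
    intro p
    by_cases hp : p ∈ L
    · obtain ⟨S, hS, h⟩ := hC.exists_level_eq he hTe ((Finset.le_sup hp).trans hN) (hL p hp)
      exact ⟨S, hS, fun _ => h⟩
    · exact ⟨∅, by simp, fun h => absurd h hp⟩
  choose S hS hSeq using h
  refine ⟨L.biUnion S, Finset.biUnion_subset.2 fun p _ => hS p, ?_⟩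
  refine (Filter.EventuallyEq.countable_bUnion L.countable_toSet fun p hp => hSeq p hp).trans
    (Eq.eventuallyEq ?_)
  refine Set.ext fun x => ?_
  simp only [Set.mem_iUnion, Finset.mem_biUnion, exists_prop]
  constructor
  · rintro ⟨p, hp, j, hj, hx⟩
    exact ⟨j, ⟨p, hp, hj⟩, hx⟩
  · rintro ⟨j, ⟨p, hp, hj⟩, hx⟩
    exact ⟨p, hp, j, hj, hx⟩

include he hTe in
theorem IsCuttingAndStacking.measure_base_ne_top (n : ℕ) : μ (C n).base ≠ ⊤ := by
  induction n with
  | zero => exact hC.measure_base_zero_ne_top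
  | succ n ih =>
    obtain ⟨P, hP, -, hPeq⟩ := hC.exists_offsets n
    obtain ⟨j, hj⟩ := Finset.card_pos.1 (show 0 < P.card by omega)
    refine ne_top_of_le_ne_top ih ?_
    rw [measure_congr hPeq, ← measure_shift (j : ℤ) _ he, ← measure_congr (hTe j _)]
    exact measure_mono (Set.subset_biUnion_of_mem (u := fun j => (C (n + 1)).level j) hj)

include he hTe in
theorem IsCuttingAndStacking.two_pow_mul_measure_base_le (n : ℕ) :
    2 ^ n * μ.real (C n).base ≤ μ.real (C 0).base := by
  induction n with
  | zero => simp
  | succ n ih =>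
    obtain ⟨P, hP, hP', hPeq⟩ := hC.exists_offsets n
    have hpos := (C n).height_pos
    have := measureReal_eq_card_mul he (C (n + 1)).measurableSet_base
      (hC.measure_base_ne_top he hTe (n + 1)) ((C (n + 1)).aedisjoint_shift hTe) (S := P)
      (fun j hj => by have := hP' j hj; rw [Finset.mem_range]; omega)
      (hPeq.trans (biUnion_ae_eq _ fun j => hTe j _))
    have h2 : (2 : ℝ) ≤ P.card := by exact_mod_cast hP
    have h3 : 2 * μ.real (C (n + 1)).base ≤ μ.real (C n).base := by
      rw [this]
      gcongr
    calc 2 ^ (n + 1) * μ.real (C (n + 1)).base = 2 ^ n * (2 * μ.real (C (n + 1)).base) := by ring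
      _ ≤ 2 ^ n * μ.real (C n).base := by gcongr
      _ ≤ _ := ih

include he hTe in
-- Since bases at least halve at each stage, `I` consists of at least `2 ^ N` levels of `C N`. The
-- quadratic lower bound then gives at least `2 ^ N * μ(I) / 2` at time `h_N`.
theorem IsCuttingAndStacking.tendsto_sum_measureReal :
    Tendsto (fun n => ∑ k ∈ Finset.range n,
      μ.real ((C 0).level 0 ∩ shift e (k : ℤ) ((C 0).level 0))) atTop atTop := by
  refine tendsto_atTop_atTop_of_monotone ?_ fun M => ?_
  · refine monotone_nat_of_le_succ fun n => ?_
    rw [Finset.sum_range_succ]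
    linarith [measureReal_nonneg (μ := μ)
      (s := (C 0).level 0 ∩ shift e ((n : ℕ) : ℤ) ((C 0).level 0))]
  · have hI : μ.real ((C 0).level 0) = μ.real (C 0).base := by
      rw [Column.level, measureReal_congr (hTe 0 _)]
      simp
    have hIpos : 0 < μ.real (C 0).base :=
      ENNReal.toReal_pos hC.measure_base_zero_pos.ne' hC.measure_base_zero_ne_top
    obtain ⟨N, hN⟩ := pow_unbounded_of_one_lt (2 * M / μ.real (C 0).base) (one_lt_two (α := ℝ))
    obtain ⟨S, hS, hSeq⟩ := hC.exists_level_eq he hTe (Nat.zero_le N) (C 0).height_pos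
    have hfin := hC.measure_base_ne_top he hTe N
    have hdisj := (C N).aedisjoint_shift hTe
    have hm := measureReal_eq_card_mul he (C N).measurableSet_base hfin hdisj hS hSeq
    refine ⟨(C N).height, le_trans ?_ (card_sq_mul_le_sum_measureReal he (C N).measurableSet_base
      hfin hdisj hS hSeq)⟩
    rw [hI] at hm
    have h2 := hC.two_pow_mul_measure_base_le he hTe N
    have hb : 0 < μ.real (C N).base := by
      refine lt_of_le_of_ne measureReal_nonneg fun h0 => ?_
      rw [← h0, mul_zero] at hm
      exact hIpos.ne' hm
    rw [hm] at h2
    have h3 := le_of_mul_le_mul_right h2 hb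
    rw [div_lt_iff₀ hIpos] at hN
    calc M ≤ 2 ^ N * μ.real (C 0).base / 2 := by linarith
      _ ≤ S.card * μ.real (C 0).base / 2 := by gcongr
      _ = _ := by rw [hm]; ring

include he hTe in
theorem IsCuttingAndStacking.weakRationalLimit {A B : Set X} (hA : IsFiniteUnionOfLevels C A)
    (hB : IsFiniteUnionOfLevels C B) : T.WeakRationalLimit ((C 0).level 0) A B := by
  obtain ⟨nA, hA⟩ := hC.exists_union_eq he hTe hA
  obtain ⟨nB, hB⟩ := hC.exists_union_eq he hTe hB
  set N := max nA nB
  obtain ⟨SA, hSA, hA⟩ := hA N (le_max_left _ _)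
  obtain ⟨SB, hSB, hB⟩ := hB N (le_max_right _ _)
  obtain ⟨SI, hSI, hI⟩ := hC.exists_level_eq he hTe (Nat.zero_le N) (C 0).height_pos
  have hfin := hC.measure_base_ne_top he hTe N
  have hdisj := (C N).aedisjoint_shift hTe
  have hbm := (C N).measurableSet_base
  have hmA := measureReal_eq_card_mul he hbm hfin hdisj hSA hA
  have hmB := measureReal_eq_card_mul he hbm hfin hdisj hSB hB
  have hmI := measureReal_eq_card_mul he hbm hfin hdisj hSI hI
  obtain ⟨K, hK⟩ := exists_abs_sum_measureReal_sub_le he hbm hfin hdisj hSA hSB hA hB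
  obtain ⟨K', hK'⟩ := exists_abs_sum_measureReal_sub_le he hbm hfin hdisj hSI hSI hI hI
  have hIpos : 0 < μ.real ((C 0).level 0) := by
    rw [Column.level, measureReal_congr (hTe 0 _)]
    simpa [measureReal_def] using ENNReal.toReal_pos hC.measure_base_zero_pos.ne' hC.measure_base_zero_ne_top
  have hIne : (SI.card : ℝ) ≠ 0 := by
    rintro h0
    rw [h0, zero_mul] at hmI
    exact hIpos.ne' hmI
  have hT := hC.tendsto_sum_measureReal he hTe
  set y := fun n : ℕ => ∑ k ∈ Finset.range n,
    μ.real ((C N).base ∩ shift e (k : ℤ) (C N).base) with hy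
  -- Divergence passes from `I` to the base of `C N`, the two sums being proportional up to the
  -- bounded error `K'`.
  have hyT : Tendsto y atTop atTop := by
    have hpos : (0 : ℝ) < SI.card * SI.card := by positivity
    refine (tendsto_const_mul_atTop_of_pos hpos).1 ?_
    refine tendsto_atTop_mono (fun n => ?_) (tendsto_atTop_add_const_right _ (-K') hT)
    linarith [(abs_le.1 (hK' n)).2]
  have h1 := tendsto_div_of_abs_sub_mul_le hyT hK
  have h2 := tendsto_div_of_abs_sub_mul_le hyT hK'
  -- The factor `μ(I)^2` is the one in the denominator of the weights; the sums `y n` cancel in the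
  -- quotient.
  have h3 := (h1.div h2 (mul_ne_zero hIne hIne)).const_mul (μ.real ((C 0).level 0) ^ 2)
  have hlim : μ.real ((C 0).level 0) ^ 2 *
      ((SA.card : ℝ) * SB.card / (SI.card * SI.card)) = μ.real A * μ.real B := by
    rw [hmA, hmB, hmI]
    field_simp
  rw [hlim] at h3
  refine h3.congr' ?_
  filter_upwards [hyT.eventually_gt_atTop 0] with n hn
  have e1 : ∀ A B : Set X, ∑ k ∈ Finset.range n, μ.real (A ∩ T.iterImage k B) =
      ∑ k ∈ Finset.range n, μ.real (A ∩ shift e (k : ℤ) B) := fun A B =>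
    Finset.sum_congr rfl fun k _ => measureReal_congr (EventuallyEq.rfl.inter (hTe k B))
  simp only [weightSum, weight]
  rw [← Finset.sum_div, e1, e1, Pi.div_apply, div_div_div_cancel_right₀ hn.ne', one_div_div]
  ring

end Presentation

end InvertibleMPT

namespace InvertibleMPT

/-- A Rokhlin tower of a bijection, with genuinely disjoint levels. -/
structure Tower {X : Type*} [MeasurableSpace X] (e : Equiv.Perm X) where
  base : Set X
  height : ℕ
  height_pos : 0 < height
  measurableSet_base : MeasurableSet base
  disjoint : ∀ i < height, ∀ j < height, i ≠ j → Disjoint (shift e i base) (shift e j base)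

/-! ### Rokhlin towers and their majority levels. -/

namespace Tower

variable {X : Type*} [MeasurableSpace X] {μ : Measure X} {e : Equiv.Perm X}

/-- The union of the levels of a tower with index in `S`. -/
def union (t : Tower e) (S : Finset ℕ) : Set X := ⋃ i ∈ S, shift e i t.base

theorem mem_union {t : Tower e} {S : Finset ℕ} {x : X} :
    x ∈ t.union S ↔ ∃ i ∈ S, x ∈ shift e i t.base := by
  simp [union]

theorem union_mono (t : Tower e) {S S' : Finset ℕ} (h : S ⊆ S') : t.union S ⊆ t.union S' :=
  Set.biUnion_subset_biUnion_left h

theorem disjoint_union (t : Tower e) {S S' : Finset ℕ} (hS : S ⊆ Finset.range t.height)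
    (hS' : S' ⊆ Finset.range t.height) (h : Disjoint S S') :
    Disjoint (t.union S) (t.union S') := by
  refine Set.disjoint_left.2 fun x hx hx' => ?_
  obtain ⟨i, hi, hx⟩ := mem_union.1 hx
  obtain ⟨j, hj, hx'⟩ := mem_union.1 hx'
  have hij : i ≠ j := fun hij => Finset.disjoint_left.1 h hi (hij ▸ hj)
  exact Set.disjoint_left.1
    (t.disjoint i (by simpa using hS hi) j (by simpa using hS' hj) hij) hx hx'

/-- The tower consisting of the levels of index at least `k`. -/
def trim (t : Tower e) (k : ℕ) (hk : k < t.height) (hm : MeasurableSet (shift e k t.base)) :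
    Tower e where
  base := shift e k t.base
  height := t.height - k
  height_pos := by omega
  measurableSet_base := hm
  disjoint i hi j hj hij := by
    rw [shift_shift, shift_shift]
    exact_mod_cast t.disjoint (i + k) (by omega) (j + k) (by omega) (by omega)

theorem union_trim (t : Tower e) {k : ℕ} (hk : k < t.height)
    (hm : MeasurableSet (shift e k t.base)) {S : Finset ℕ} (hS : ∀ i ∈ S, k ≤ i) :
    (t.trim k hk hm).union (S.image (· - k)) = t.union S := by
  ext x
  simp only [mem_union, Finset.mem_image, trim, shift_shift]
  constructor
  · rintro ⟨_, ⟨i, hi, rfl⟩, hx⟩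
    refine ⟨i, hi, ?_⟩
    rwa [Nat.cast_sub (hS i hi), sub_add_cancel] at hx
  · rintro ⟨i, hi, hx⟩
    refine ⟨_, ⟨i, hi, rfl⟩, ?_⟩
    rwa [Nat.cast_sub (hS i hi), sub_add_cancel]

variable (μ) in
/-- The towers `D m` approximate every set of finite measure in the limit. -/
def Converges (D : ℕ → Tower e) : Prop :=
  ∀ A : Set X, MeasurableSet A → μ A ≠ ⊤ → ∀ ε : ENNReal, 0 < ε → ∀ᶠ m in atTop,
    ∃ S ⊆ Finset.range (D m).height, μ (symmDiff A ((D m).union S)) < ε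

variable (he : ∀ k : ℤ, MeasurePreserving (e ^ k) μ μ)

include he

theorem measure_levels_le (t : Tower e) (S : Finset ℕ) : μ (t.union S) ≤ S.card * μ t.base := by
  refine (measure_biUnion_finset_le _ _).trans ?_
  simp [measure_shift _ _ he]

theorem sum_measure_inter_eq (t : Tower e) {S : Finset ℕ} (hS : S ⊆ Finset.range t.height)
    {A : Set X} (hA : MeasurableSet A) :
    ∑ i ∈ S, μ (shift e i t.base ∩ A) = μ (t.union S ∩ A) := by
  rw [union, Set.iUnion₂_inter, measure_biUnion_finset]
  · intro i hi j hj hij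
    exact (t.disjoint i (by simpa using hS hi) j (by simpa using hS hj) hij).mono
      Set.inter_subset_left Set.inter_subset_left
  · exact fun i _ => (measurableSet_shift _ he t.measurableSet_base).inter hA

/-- Brought back to the base, the two majorities each occupy more than half of it, so they overlap.
Recurrence, ergodicity and the separation of copies all come from this. -/
theorem measure_inter_shift_ne_zero {b A A' : Set X} (hbm : MeasurableSet b)
    (hA' : MeasurableSet A') {i j : ℤ} (hi : μ b < 2 * μ (shift e i b ∩ A))
    (hj : μ b < 2 * μ (shift e j b ∩ A')) : μ (A ∩ shift e (i - j) A') ≠ 0 := by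
  intro h0
  set P := b ∩ shift e (-i) A
  set Q := b ∩ shift e (-j) A'
  have hP : μ (shift e i b ∩ A) = μ P := by
    rw [← measure_shift (-i) _ he, shift_inter, shift_shift]
    simp [P]
  have hQ : μ (shift e j b ∩ A') = μ Q := by
    rw [← measure_shift (-j) _ he, shift_inter, shift_shift]
    simp [Q]
  have hPQ : μ (P ∩ Q) = 0 := by
    refine measure_mono_null (t := shift e (-i) (A ∩ shift e (i - j) A')) ?_ ?_
    · rintro x ⟨⟨-, hx⟩, -, hx'⟩
      rw [shift_inter, shift_shift]
      refine ⟨hx, ?_⟩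
      rwa [show -i + (i - j) = -j by ring]
    · rw [measure_shift _ _ he, h0]
  have hadd := measure_union_add_inter (μ := μ) P (hbm.inter (measurableSet_shift (-j) he hA'))
  rw [hPQ, add_zero] at hadd
  have hle : μ (P ∪ Q) ≤ μ b :=
    measure_mono (Set.union_subset Set.inter_subset_left Set.inter_subset_left)
  have h2 : μ b + μ b < 2 * μ P + 2 * μ Q := ENNReal.add_lt_add (hP ▸ hi) (hQ ▸ hj)
  rw [← mul_add, ← hadd, ← two_mul] at h2
  exact absurd h2 (not_lt.2 (by gcongr))

/-- Among the levels approximating `E`, one may keep those mostly contained in `E` and at distance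
at least `h` from the top. -/
theorem exists_majority (t : Tower e) (hb : μ t.base ≠ ⊤) {E : Set X} (hE : MeasurableSet E)
    (h : ℕ) {U : Finset ℕ} (hU : U ⊆ Finset.range t.height) :
    ∃ J ⊆ U, (∀ i ∈ J, i + h ≤ t.height ∧ μ t.base < 2 * μ (shift e i t.base ∩ E)) ∧
      μ (symmDiff E (t.union J)) ≤ 3 * μ (symmDiff E (t.union U)) + h * μ t.base := by
  classical
  set J := U.filter fun i : ℕ => i + h ≤ t.height ∧ μ t.base < 2 * μ (shift e i t.base ∩ E) with hJ
  set U₁ := U.filter fun i : ℕ => 2 * μ (shift e i t.base ∩ E) ≤ μ t.base with hU₁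
  set U₂ := (Finset.range t.height).filter fun i : ℕ => t.height < i + h with hU₂
  refine ⟨J, Finset.filter_subset _ _, fun i hi => (Finset.mem_filter.1 hi).2, ?_⟩
  have hsub : symmDiff E (t.union J) ⊆ symmDiff E (t.union U) ∪ (t.union U₁ ∪ t.union U₂) := by
    rintro x (⟨hx, hxJ⟩ | ⟨hx, hxE⟩)
    · by_cases hxU : x ∈ t.union U
      · right
        obtain ⟨i, hi, hxi⟩ := mem_union.1 hxU
        by_cases h1 : 2 * μ (shift e i t.base ∩ E) ≤ μ t.base
        · exact Or.inl (mem_union.2 ⟨i, Finset.mem_filter.2 ⟨hi, h1⟩, hxi⟩)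
        by_cases h2 : t.height < i + h
        · exact Or.inr (mem_union.2 ⟨i, Finset.mem_filter.2 ⟨hU hi, h2⟩, hxi⟩)
        · exact absurd (mem_union.2 ⟨i, Finset.mem_filter.2
            ⟨hi, not_lt.1 h2, not_le.1 h1⟩, hxi⟩) hxJ
      · exact Or.inl (Or.inl ⟨hx, hxU⟩)
    · exact Or.inl (Or.inr ⟨t.union_mono (Finset.filter_subset _ _) hx, hxE⟩)
  have h2 : U₂.card ≤ h := by
    have : U₂ ⊆ Finset.Ico (t.height - h) t.height := by
      intro i hi
      rw [hU₂, Finset.mem_filter, Finset.mem_range] at hi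
      rw [Finset.mem_Ico]
      omega
    refine (Finset.card_le_card this).trans ?_
    rw [Nat.card_Ico]
    omega
  -- A level of `U₁` lies at least half outside `E`, so its measure is at most twice the error it
  -- already causes; this accounts for two of the three error terms.
  have h1 : μ (t.union U₁) ≤ 2 * μ (symmDiff E (t.union U)) := by
    have hlev : ∀ i ∈ U₁, μ t.base ≤ 2 * μ (shift e i t.base ∩ Eᶜ) := by
      intro i hi
      have h := (Finset.mem_filter.1 hi).2
      have hsum : μ (shift e i t.base ∩ E) + μ (shift e i t.base ∩ Eᶜ) = μ t.base := by
        rw [← Set.sdiff_eq, measure_inter_add_sdiff _ hE, measure_shift _ _ he]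
      have hfin : μ t.base + μ t.base ≤ μ t.base + 2 * μ (shift e i t.base ∩ Eᶜ) := by
        calc μ t.base + μ t.base = 2 * μ (shift e i t.base ∩ E) +
              2 * μ (shift e i t.base ∩ Eᶜ) := by rw [← two_mul, ← hsum, mul_add]
          _ ≤ _ := by gcongr
      exact (ENNReal.add_le_add_iff_left hb).1 hfin
    calc μ (t.union U₁) ≤ ∑ i ∈ U₁, μ t.base := by
          simpa using t.measure_levels_le he U₁
      _ ≤ ∑ i ∈ U₁, 2 * μ (shift e i t.base ∩ Eᶜ) := Finset.sum_le_sum hlev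
      _ = 2 * μ (t.union U₁ ∩ Eᶜ) := by
          rw [← Finset.mul_sum, t.sum_measure_inter_eq he
            ((Finset.filter_subset _ _).trans hU) hE.compl]
      _ ≤ _ := by
          gcongr
          rintro x ⟨hx, hxE⟩
          exact Or.inr ⟨t.union_mono (Finset.filter_subset _ _) hx, hxE⟩
  calc μ (symmDiff E (t.union J)) ≤ μ (symmDiff E (t.union U)) +
        (μ (t.union U₁) + μ (t.union U₂)) :=
      (measure_mono hsub).trans ((measure_union_le _ _).trans
        (add_le_add le_rfl (measure_union_le _ _)))
    _ ≤ μ (symmDiff E (t.union U)) + (2 * μ (symmDiff E (t.union U)) + h * μ t.base) := by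
        gcongr
        exact (t.measure_levels_le he U₂).trans (by gcongr)
    _ = _ := by ring

/-! ### Conservativity and ergodicity from converging towers. -/

section Sequence

variable {D : ℕ → Tower e} (hD : Converges μ D)
  (hsmall : ∀ ε : ENNReal, 0 < ε → ∀ᶠ m in atTop, μ (D m).base < ε)

include hD

/-- Test a single set `A` of measure below `ε / 2`, with tolerance `μ A`. The approximating union
can be neither null nor empty, and any of its levels lies in `A` up to an error below `ε / 2`. -/
theorem eventually_measure_base (hμ : ∀ δ : ENNReal, 0 < δ → ∃ A, MeasurableSet A ∧
    0 < μ A ∧ μ A < δ) {ε : ENNReal} (hε : 0 < ε) :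
    ∀ᶠ m in atTop, 0 < μ (D m).base ∧ μ (D m).base < ε := by
  obtain ⟨A, hA, hA0, hAε⟩ := hμ (min (ε / 2) 1) (by simp [hε.ne'])
  have hAtop : μ A ≠ ⊤ := ne_top_of_lt hAε
  filter_upwards [hD A hA hAtop _ hA0] with m ⟨S, _, hS⟩
  constructor
  · refine pos_iff_ne_zero.2 fun h0 => absurd hS (not_lt.2 ?_)
    have hU : μ ((D m).union S) = 0 := by
      simpa [h0] using (D m).measure_levels_le he S
    refine le_trans (measure_mono (t := symmDiff A ((D m).union S) ∪ (D m).union S) ?_)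
      ((measure_union_le _ _).trans (by rw [hU, add_zero]))
    intro x hx
    by_cases hxU : x ∈ (D m).union S
    · exact Or.inr hxU
    · exact Or.inl (Or.inl ⟨hx, hxU⟩)
  · obtain ⟨i, hi⟩ : S.Nonempty := by
      rw [Finset.nonempty_iff_ne_empty]
      rintro rfl
      have h0 : symmDiff A ((D m).union ∅) = A := by simp [union, Set.symmDiff_def]
      exact lt_irrefl _ (h0 ▸ hS)
    have hsub : shift e i (D m).base ⊆ A ∪ symmDiff A ((D m).union S) := by
      intro x hx
      by_cases hxA : x ∈ A
      · exact Or.inl hxA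
      · exact Or.inr (Or.inr ⟨mem_union.2 ⟨i, hi, hx⟩, hxA⟩)
    calc μ (D m).base ≤ μ A + μ (symmDiff A ((D m).union S)) := by
          rw [← measure_shift (i : ℤ) _ he]
          exact (measure_mono hsub).trans (measure_union_le _ _)
      _ < ε / 2 + ε / 2 := ENNReal.add_lt_add (hAε.trans_le (min_le_left _ _))
          (hS.trans (hAε.trans_le (min_le_left _ _)))
      _ = ε := ENNReal.add_halves ε

include hsmall

theorem eventually_exists_majority {E : Set X} (hE : MeasurableSet E) (hE0 : 0 < μ E)
    (hEtop : μ E ≠ ⊤) (h : ℕ) {ε : ENNReal} (hε : 0 < ε) :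
    ∀ᶠ m in atTop, ∃ J ⊆ Finset.range (D m).height, 2 ≤ J.card ∧
      (∀ i ∈ J, i + h ≤ (D m).height ∧
        μ (D m).base < 2 * μ (shift e i (D m).base ∩ E)) ∧
      μ (symmDiff E ((D m).union J)) < ε := by
  -- Approximation within `η / 6`, tripled by `exists_majority`, costs `η / 2`; bases below `η / 2 /
  -- (h + 1)` pay for the top levels. The bound `η ≤ μ E / 2` is what forces two levels: a single
  -- one would leave `μ E < η + η`.
  set η := min ε (μ E / 2)
  have hη : 0 < η := by simp [η, hε, hE0.ne']
  have hηtop : η ≠ ⊤ := ne_top_of_le_ne_top (ENNReal.div_ne_top hEtop two_ne_zero) (min_le_right _ _)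
  have hη6 : 0 < η / 6 := ENNReal.div_pos hη.ne' (by norm_num)
  filter_upwards [hD E hE hEtop _ hη6, hsmall (η / 2 / (h + 1))
    (ENNReal.div_pos (ENNReal.div_pos hη.ne' (by norm_num)).ne' (by finiteness))]
    with m ⟨U, hU, hUlt⟩ hb
  have hbtop : μ (D m).base ≠ ⊤ := ne_top_of_lt hb
  obtain ⟨J, hJU, hJ, hJlt⟩ := (D m).exists_majority he hbtop hE h hU
  rw [ENNReal.lt_div_iff_mul_lt (Or.inl (by simp)) (Or.inl (by finiteness))] at hb
  rw [ENNReal.lt_div_iff_mul_lt (Or.inl (by simp)) (Or.inl (by finiteness))] at hUlt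
  have hlt : μ (symmDiff E ((D m).union J)) < η := by
    refine hJlt.trans_lt ?_
    have h1 : h * μ (D m).base ≤ μ (D m).base * (h + 1) := by
      rw [mul_comm]
      gcongr
      exact le_self_add
    have h2 : 3 * μ (symmDiff E ((D m).union U)) < η / 2 := by
      rw [ENNReal.lt_div_iff_mul_lt (Or.inl (by simp)) (Or.inl (by simp))]
      calc _ = μ (symmDiff E ((D m).union U)) * 6 := by ring
        _ < _ := hUlt
    calc _ < η / 2 + η / 2 := ENNReal.add_lt_add h2 (h1.trans_lt hb)
      _ = η := ENNReal.add_halves η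
  refine ⟨J, hJU.trans hU, ?_, hJ, hlt.trans_le (min_le_left _ _)⟩
  by_contra! hcard
  have hUJ : μ ((D m).union J) < η := by
    refine ((D m).measure_levels_le he J).trans_lt (lt_of_le_of_lt ?_
      (hb.trans_le ENNReal.half_le_self))
    rw [mul_comm]
    have h1 : (J.card : ENNReal) ≤ 1 := by exact_mod_cast (by omega : J.card ≤ 1)
    gcongr
    exact h1.trans le_add_self
  have hsub : E ⊆ symmDiff E ((D m).union J) ∪ (D m).union J := by
    intro x hx
    by_cases hxU : x ∈ (D m).union J
    · exact Or.inr hxU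
    · exact Or.inl (Or.inl ⟨hx, hxU⟩)
  have : μ E < η + η :=
    ((measure_mono hsub).trans (measure_union_le _ _)).trans_lt (ENNReal.add_lt_add hlt hUJ)
  refine absurd this (not_lt.2 ?_)
  calc η + η ≤ μ E / 2 + μ E / 2 := add_le_add (min_le_right _ _) (min_le_right _ _)
    _ = μ E := ENNReal.add_halves _

/-- A nonnull `W` would be the majority of two levels of one tower, and would then meet its
translate by their positive distance. -/
theorem measure_eq_zero_of_wandering {W : Set X} (hW : MeasurableSet W) (hWtop : μ W ≠ ⊤)
    (hdisj : ∀ k : ℕ, 0 < k → μ (W ∩ shift e k W) = 0) : μ W = 0 := by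
  by_contra h0
  obtain ⟨m, ⟨J, hJ, hcard, hmaj, -⟩, hb⟩ := ((eventually_exists_majority he hD hsmall hW
    (pos_iff_ne_zero.2 h0) hWtop 0 one_pos).and (hsmall 1 one_pos)).exists
  obtain ⟨i, hi, j, hj, hij⟩ := Finset.one_lt_card.1 hcard
  wlog hlt : i < j generalizing i j
  · exact this j hj i hi hij.symm (by omega)
  have := measure_inter_shift_ne_zero he (D m).measurableSet_base hW
    (hmaj j hj).2 (hmaj i hi).2
  rw [← Nat.cast_sub hlt.le] at this
  exact this (hdisj _ (by omega))

/-- The set `F \ shift e 1 F` is wandering, hence null, so the forward sweep `F` absorbs the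
backward translates of `E` too. A nonnull set outside `F` would share a tower with `E`, each having
a majority level, and so would meet some translate of `E`. -/
theorem measure_compl_iUnion_shift [SigmaFinite μ] {E : Set X} (hE : MeasurableSet E)
    (hE0 : 0 < μ E) (hEtop : μ E ≠ ⊤) : μ (⋃ k : ℕ, shift e k E)ᶜ = 0 := by
  set F := ⋃ k : ℕ, shift e k E with hF
  have hFm : MeasurableSet F := MeasurableSet.iUnion fun k => measurableSet_shift _ he hE
  have hmono : ∀ k : ℕ, 0 < k → shift e k F ⊆ shift e 1 F := by
    intro k hk x hx
    rw [hF, shift_iUnion] at hx ⊢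
    obtain ⟨n, hn⟩ := Set.mem_iUnion.1 hx
    refine Set.mem_iUnion.2 ⟨k + n - 1, ?_⟩
    rw [shift_shift] at hn ⊢
    rwa [Nat.cast_sub (by omega), show (1 : ℤ) + (((k + n : ℕ) : ℤ) - (1 : ℕ)) = k + n by
      push_cast; ring]
  have hWE : F \ shift e 1 F ⊆ E := by
    rintro x ⟨hx, hx'⟩
    obtain ⟨n, hn⟩ := Set.mem_iUnion.1 hx
    cases n with
    | zero => simpa using hn
    | succ n =>
      refine absurd ?_ hx'
      rw [hF, shift_iUnion]
      refine Set.mem_iUnion.2 ⟨n, ?_⟩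
      rw [shift_shift, add_comm]
      exact_mod_cast hn
  have hW0 : μ (F \ shift e 1 F) = 0 := by
    refine measure_eq_zero_of_wandering he hD hsmall (hFm.diff (measurableSet_shift _ he hFm))
      (ne_top_of_le_ne_top hEtop (measure_mono hWE)) fun k hk => ?_
    convert measure_empty (μ := μ)
    refine Set.eq_empty_of_forall_notMem ?_
    rintro x ⟨⟨-, hx⟩, hx'⟩
    exact hx (hmono k hk (shift_mono e k Set.sdiff_subset hx'))
  have hFn : ∀ n : ℕ, μ (F \ shift e n F) = 0 := by
    intro n
    induction n with
    | zero => simp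
    | succ n ih =>
      refine measure_mono_null (t := (F \ shift e 1 F) ∪ shift e 1 (F \ shift e n F)) ?_ ?_
      · rintro x ⟨hx, hx'⟩
        by_cases h1 : x ∈ shift e 1 F
        · refine Or.inr ?_
          rw [shift_diff, shift_shift, add_comm]
          exact ⟨h1, by exact_mod_cast hx'⟩
        · exact Or.inl ⟨hx, h1⟩
      · rw [measure_union_null_iff, measure_shift _ _ he]
        exact ⟨hW0, ih⟩
  have hEF : E ⊆ F := fun x hx => Set.mem_iUnion.2 ⟨0, by simpa using hx⟩
  have hk : ∀ k : ℤ, μ (shift e k E \ F) = 0 := by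
    intro k
    obtain ⟨n, rfl | rfl⟩ := k.eq_nat_or_neg
    · convert measure_empty (μ := μ)
      rw [Set.sdiff_eq_empty]
      exact Set.subset_iUnion (fun k : ℕ => shift e k E) n
    · rw [← measure_shift (n : ℤ) _ he, shift_diff, shift_shift, add_neg_cancel, shift_zero]
      exact measure_mono_null (Set.sdiff_subset_sdiff_left hEF) (hFn n)
  by_contra h0
  obtain ⟨A, hA, hAF, hA0, hAtop⟩ := Measure.exists_subset_measure_lt_top hFm.compl
    (pos_iff_ne_zero.2 h0)
  obtain ⟨m, ⟨⟨J, -, hJ, hJmaj, -⟩, ⟨J', -, hJ', hJmaj', -⟩⟩, hb⟩ :=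
    (((eventually_exists_majority he hD hsmall hA hA0 hAtop.ne 0 one_pos).and
      (eventually_exists_majority he hD hsmall hE hE0 hEtop 0 one_pos)).and
      (hsmall 1 one_pos)).exists
  obtain ⟨i, hi⟩ := Finset.card_pos.1 (show 0 < J.card by omega)
  obtain ⟨j, hj⟩ := Finset.card_pos.1 (show 0 < J'.card by omega)
  refine measure_inter_shift_ne_zero he (D m).measurableSet_base hE
    (hJmaj i hi).2 (hJmaj' j hj).2 (measure_mono_null ?_ (hk (i - j)))
  rintro x ⟨hx, hx'⟩
  exact ⟨hx', hAF hx⟩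

end Sequence

/-- If `E` sweeps out the space, the part of a thin tower below its first levels meeting `E`
contains little of any given set of finite measure. -/
theorem exists_measure_inter_bottom_lt {E A : Set X} (hE : MeasurableSet E)
    (hsweep : μ (⋃ k : ℕ, shift e k E)ᶜ = 0) (hA : MeasurableSet A) (hAtop : μ A ≠ ⊤)
    {ε : ENNReal} (hε : 0 < ε) (hεtop : ε ≠ ⊤) : ∃ δ : ENNReal, 0 < δ ∧ ∀ (t : Tower e) (n : ℕ),
      μ t.base < δ → μ (t.union (Finset.range n) ∩ E) < δ →
      μ (A ∩ t.union (Finset.range n)) < ε := by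
  -- Up to `ε / 2`, finitely many forward translates of `E` cover `A`, so it suffices to bound the
  -- bottom part `L` inside each of them.
  obtain ⟨K, hK⟩ : ∃ K : ℕ, μ (A \ ⋃ k ∈ Finset.range K, shift e k E) < ε / 2 := by
    have hT : Tendsto (fun K : ℕ => μ (A \ ⋃ k ∈ Finset.range K, shift e k E)) atTop
        (𝓝 (μ (⋂ K : ℕ, A \ ⋃ k ∈ Finset.range K, shift e k E))) := by
      refine tendsto_measure_iInter_atTop (fun K => (hA.diff (Finset.measurableSet_biUnion _
        fun k _ => measurableSet_shift _ he hE)).nullMeasurableSet) ?_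
        ⟨0, ne_top_of_le_ne_top hAtop (measure_mono Set.sdiff_subset)⟩
      intro K K' hKK'
      refine Set.sdiff_subset_sdiff_right (Set.biUnion_subset_biUnion_left ?_)
      intro k hk
      have : k < K := by simpa using hk
      simpa using this.trans_le hKK'
    have h0 : μ (⋂ K : ℕ, A \ ⋃ k ∈ Finset.range K, shift e k E) = 0 := by
      refine measure_mono_null ?_ hsweep
      intro x hx hx'
      obtain ⟨k, hk⟩ := Set.mem_iUnion.1 hx'
      exact (Set.mem_iInter.1 hx (k + 1)).2 (Set.mem_biUnion (x := k) (by simp) hk)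
    rw [h0] at hT
    exact (hT.eventually_lt_const (ENNReal.half_pos hε.ne')).exists
  refine ⟨min (ε / 2 / (K * (K + 1) + 1)) 1, lt_min (ENNReal.div_pos (ENNReal.half_pos hε.ne').ne'
    (by finiteness)) one_pos, fun t n hb hn => ?_⟩
  set δ := min (ε / 2 / (K * (K + 1) + 1)) 1
  set L := t.union (Finset.range n)
  have hlev : ∀ k ∈ Finset.range K, μ (L ∩ shift e k E) ≤ (K + 1) * δ := by
    intro k hk
    -- Moving a point of `L` down by `k` levels either keeps it in `L`, where it lies in `E`, or
    -- means that it started among the first `k` levels.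
    have hsub : L ∩ shift e k E ⊆ t.union (Finset.range k) ∪ shift e k (L ∩ E) := by
      rintro x ⟨hx, hxE⟩
      obtain ⟨i, hi, hxi⟩ := mem_union.1 hx
      by_cases hik : i < k
      · exact Or.inl (mem_union.2 ⟨i, by simpa using hik, hxi⟩)
      · refine Or.inr ⟨mem_union.2 ⟨i - k, ?_, ?_⟩, hxE⟩
        · rw [Finset.mem_range] at hi ⊢
          omega
        · rw [← mem_shift, shift_shift, Nat.cast_sub (by omega), add_sub_cancel]
          exact hxi
    have hkK : (k : ENNReal) ≤ K := by exact_mod_cast (Finset.mem_range.1 hk).le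
    calc μ (L ∩ shift e k E) ≤ μ (t.union (Finset.range k)) + μ (L ∩ E) := by
          rw [← measure_shift (k : ℤ) (L ∩ E) he]
          exact (measure_mono hsub).trans (measure_union_le _ _)
      _ ≤ K * δ + δ := by
          gcongr
          refine (t.measure_levels_le he _).trans ?_
          rw [Finset.card_range]
          gcongr
      _ = _ := by ring
  have hsub : A ∩ L ⊆ (A \ ⋃ k ∈ Finset.range K, shift e k E) ∪
      ⋃ k ∈ Finset.range K, (L ∩ shift e k E) := by
    rintro x ⟨hx, hxL⟩
    by_cases h : x ∈ ⋃ k ∈ Finset.range K, shift e k E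
    · obtain ⟨k, hk, hxk⟩ := Set.mem_iUnion₂.1 h
      exact Or.inr (Set.mem_iUnion₂.2 ⟨k, hk, hxL, hxk⟩)
    · exact Or.inl ⟨hx, h⟩
  calc μ (A ∩ L) ≤ μ (A \ ⋃ k ∈ Finset.range K, shift e k E) +
        ∑ k ∈ Finset.range K, μ (L ∩ shift e k E) :=
      (measure_mono hsub).trans ((measure_union_le _ _).trans
        (add_le_add le_rfl (measure_biUnion_finset_le _ _)))
    _ ≤ μ (A \ ⋃ k ∈ Finset.range K, shift e k E) + ε / 2 := by
        gcongr
        refine (Finset.sum_le_sum hlev).trans ?_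
        rw [Finset.sum_const, Finset.card_range, nsmul_eq_mul, ← mul_assoc]
        calc (K : ENNReal) * (K + 1) * δ
            ≤ (K * (K + 1) + 1) * (ε / 2 / (K * (K + 1) + 1)) := by
              gcongr
              · exact le_self_add
              · exact min_le_left _ _
          _ ≤ ε / 2 := ENNReal.mul_div_le
    _ < ε / 2 + ε / 2 := ENNReal.add_lt_add_right (ENNReal.div_ne_top hεtop two_ne_zero) hK
    _ = ε := ENNReal.add_halves ε

end Tower

end InvertibleMPT

namespace InvertibleMPT

/-! ### Almost nested towers. -/

namespace Tower

variable {X : Type*} [MeasurableSpace X] {μ : Measure X} {e : Equiv.Perm X}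

/-- The levels of `t'` with index in `J` can serve as the bases of at least two disjoint copies of
`t` inside `t'`, the first of which starts at the bottom. -/
structure IsCopies (t t' : Tower e) (J : Finset ℕ) : Prop where
  zero_mem : 0 ∈ J
  two_le_card : 2 ≤ J.card
  add_height_le : ∀ j ∈ J, j + t.height ≤ t'.height
  separated : ∀ i ∈ J, ∀ j ∈ J, i < j → i + t.height ≤ j

theorem IsCopies.card_mul_height_le {t t' : Tower e} {J : Finset ℕ} (h : IsCopies t t' J) :
    J.card * t.height ≤ t'.height := by
  have hdisj : (J : Set ℕ).PairwiseDisjoint fun j => Finset.Ico j (j + t.height) := by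
    intro i hi j hj hij
    refine Finset.disjoint_left.2 fun x hx hx' => ?_
    rw [Finset.mem_Ico] at hx hx'
    rcases lt_or_gt_of_ne hij with hlt | hlt
    · have := h.separated i hi j hj hlt
      omega
    · have := h.separated j hj i hi hlt
      omega
  have hcard := Finset.card_biUnion hdisj
  simp only [Nat.card_Ico, add_tsub_cancel_left, Finset.sum_const, smul_eq_mul] at hcard
  rw [← hcard, ← Finset.card_range t'.height]
  refine Finset.card_le_card (Finset.biUnion_subset.2 fun j hj x hx => ?_)
  have := h.add_height_le j hj
  rw [Finset.mem_Ico] at hx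
  rw [Finset.mem_range]
  omega

/-- The copies start at the majority levels of `t.base` in a late tower `D m`, which is trimmed so
that the first of them becomes its bottom. The family `𝓕` lists the sets whose approximation must
survive the trimming. -/
theorem exists_copies [SigmaFinite μ] (he : ∀ k : ℤ, MeasurePreserving (e ^ k) μ μ)
    {D : ℕ → Tower e} (hD : Converges μ D)
    (hsmall : ∀ ε : ENNReal, 0 < ε → ∀ᶠ m in atTop, 0 < μ (D m).base ∧ μ (D m).base < ε)
    (t : Tower e) (ht0 : 0 < μ t.base) (httop : μ t.base ≠ ⊤) {ι : Type*} (𝓕 : Finset ι)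
    {F : ι → Set X} (hF : ∀ i ∈ 𝓕, MeasurableSet (F i)) (hFtop : ∀ i ∈ 𝓕, μ (F i) ≠ ⊤)
    {ε : ENNReal} (hε : 0 < ε) :
    ∃ (t' : Tower e) (J : Finset ℕ), 0 < μ t'.base ∧ μ t'.base ≠ ⊤ ∧ IsCopies t t' J ∧
      μ (symmDiff t.base (t'.union J)) < ε ∧
      ∀ i ∈ 𝓕, ∃ U ⊆ Finset.range t'.height, μ (symmDiff (F i) (t'.union U)) < ε := by
  classical
  have hsmall' : ∀ ε : ENNReal, 0 < ε → ∀ᶠ m in atTop, μ (D m).base < ε :=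
    fun ε hε => (hsmall ε hε).mono fun _ h => h.2
  wlog hεtop : ε ≠ ⊤ generalizing ε
  · rw [not_not] at hεtop
    obtain ⟨t', J, h1, h2, h3, h4, h5⟩ := this one_pos ENNReal.one_ne_top
    refine ⟨t', J, h1, h2, h3, h4.trans_le (by simp [hεtop]), fun i hi => ?_⟩
    obtain ⟨U, hU, hlt⟩ := h5 i hi
    exact ⟨U, hU, hlt.trans_le (by simp [hεtop])⟩
  have hε2 := ENNReal.half_pos hε.ne'
  have hsweep := measure_compl_iUnion_shift he hD hsmall' t.measurableSet_base ht0 httop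
  have hδ : ∀ i, ∃ δ : ENNReal, 0 < δ ∧ (i ∈ 𝓕 → ∀ (t' : Tower e) (n : ℕ), μ t'.base < δ →
      μ (t'.union (Finset.range n) ∩ t.base) < δ →
      μ (F i ∩ t'.union (Finset.range n)) < ε / 2) := by
    intro i
    by_cases hi : i ∈ 𝓕
    · obtain ⟨δ, hδ, h⟩ := exists_measure_inter_bottom_lt he t.measurableSet_base hsweep
        (hF i hi) (hFtop i hi) hε2 (ENNReal.div_ne_top hεtop two_ne_zero)
      exact ⟨δ, hδ, fun _ => h⟩
    · exact ⟨1, one_pos, fun h => absurd h hi⟩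
  choose δ hδ0 hδ using hδ
  set δ₀ := 𝓕.inf δ with hδ₀
  have hδ₀0 : 0 < δ₀ := (Finset.lt_inf_iff (by simp)).2 fun i _ => hδ0 i
  have happrox : ∀ᶠ m in atTop, ∀ i ∈ 𝓕, ∃ U ⊆ Finset.range (D m).height,
      μ (symmDiff (F i) ((D m).union U)) < ε / 2 :=
    (Finset.eventually_all 𝓕).2 fun i hi => hD _ (hF i hi) (hFtop i hi) _ hε2
  obtain ⟨m, ⟨⟨J, hJ, hJcard, hJmaj, hJlt⟩, hU⟩, hb0, hblt⟩ :=
    (((eventually_exists_majority he hD hsmall' t.measurableSet_base ht0 httop t.height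
      (lt_min hε hδ₀0)).and happrox).and (hsmall _ (lt_min one_pos hδ₀0))).exists
  have hJne : J.Nonempty := Finset.card_pos.1 (by omega)
  set k := J.min' hJne with hk
  have hkJ : k ∈ J := J.min'_mem hJne
  have hkle : ∀ i ∈ J, k ≤ i := fun i hi => J.min'_le i hi
  have hkH : k < (D m).height := by simpa using hJ hkJ
  have hm := measurableSet_shift (k : ℤ) he (D m).measurableSet_base
  -- Majority levels closer than `t.height` would make `t.base` meet one of the other levels of `t`.
  have hsep : ∀ i ∈ J, ∀ j ∈ J, i < j → i + t.height ≤ j := by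
    intro i hi j hj hij
    by_contra! hlt
    refine measure_inter_shift_ne_zero he (D m).measurableSet_base t.measurableSet_base
      (hJmaj j hj).2 (hJmaj i hi).2 ?_
    have hd := t.disjoint 0 t.height_pos (j - i) (by omega) (by omega)
    rw [Nat.cast_zero, shift_zero, Nat.cast_sub hij.le] at hd
    rw [hd.inter_eq, measure_empty]
  refine ⟨(D m).trim k hkH hm, J.image (· - k), ?_, ?_, ⟨?_, ?_, ?_, ?_⟩, ?_, ?_⟩
  · rwa [trim, measure_shift _ _ he]
  · rw [trim, measure_shift _ _ he]
    exact ne_top_of_lt hblt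
  · exact Finset.mem_image.2 ⟨k, hkJ, Nat.sub_self k⟩
  · rwa [Finset.card_image_of_injOn]
    intro i hi j hj hij
    have h1 := hkle i hi
    have h2 := hkle j hj
    simp only at hij
    omega
  · intro j hj
    obtain ⟨i, hi, rfl⟩ := Finset.mem_image.1 hj
    have h1 := hkle i hi
    have h2 := (hJmaj i hi).1
    simp only [trim]
    omega
  · intro i hi j hj hij
    obtain ⟨i, hi, rfl⟩ := Finset.mem_image.1 hi
    obtain ⟨j, hj, rfl⟩ := Finset.mem_image.1 hj
    have h1 := hkle i ‹i ∈ J›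
    have h3 := hsep i ‹i ∈ J› j ‹j ∈ J› (by omega)
    omega
  · rw [union_trim _ hkH hm hkle]
    exact hJlt.trans_le (min_le_left _ _)
  · intro i hi
    obtain ⟨U, hU, hUlt⟩ := hU i hi
    set V := U.filter fun i => k ≤ i with hV
    have hVk : ∀ i ∈ V, k ≤ i := fun i hi => (Finset.mem_filter.1 hi).2
    refine ⟨V.image (· - k), ?_, ?_⟩
    · intro j hj
      obtain ⟨i, hi, rfl⟩ := Finset.mem_image.1 hj
      have h1 := Finset.mem_range.1 (hU (Finset.mem_filter.1 hi).1)
      have h2 := hVk i hi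
      rw [Finset.mem_range, trim]
      simp only
      omega
    · rw [union_trim _ hkH hm hVk]
      -- The discarded levels are disjoint from those indexed by `J`, so their part in `t.base` is
      -- approximation error; by sweeping they then contain little of `F i`.
      have hbot : μ (F i ∩ (D m).union (Finset.range k)) < ε / 2 := by
        refine hδ i hi (D m) k ((hblt.trans_le (min_le_right _ _)).trans_le (Finset.inf_le hi))
          (lt_of_le_of_lt ?_ ((hJlt.trans_le (min_le_right _ _)).trans_le (Finset.inf_le hi)))
        refine measure_mono ?_
        rintro x ⟨hx, hxt⟩
        refine Or.inl ⟨hxt, Set.disjoint_left.1 ((D m).disjoint_union ?_ hJ ?_) hx⟩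
        · intro i hi
          rw [Finset.mem_range] at hi ⊢
          omega
        · refine Finset.disjoint_left.2 fun i hi hi' => ?_
          have := hkle i hi'
          rw [Finset.mem_range] at hi
          omega
      have hsub : symmDiff (F i) ((D m).union V) ⊆ symmDiff (F i) ((D m).union U) ∪
          (F i ∩ (D m).union (Finset.range k)) := by
        rintro x (⟨hx, hxV⟩ | ⟨hx, hxF⟩)
        · by_cases hxU : x ∈ (D m).union U
          · obtain ⟨j, hj, hxj⟩ := mem_union.1 hxU
            have hjk : j < k := by
              by_contra! hjk
              exact hxV (mem_union.2 ⟨j, Finset.mem_filter.2 ⟨hj, hjk⟩, hxj⟩)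
            exact Or.inr ⟨hx, mem_union.2 ⟨j, Finset.mem_range.2 hjk, hxj⟩⟩
          · exact Or.inl (Or.inl ⟨hx, hxU⟩)
        · exact Or.inl (Or.inr ⟨(D m).union_mono (Finset.filter_subset _ _) hx, hxF⟩)
      calc μ (symmDiff (F i) ((D m).union V)) ≤ _ :=
            (measure_mono hsub).trans (measure_union_le _ _)
        _ < ε / 2 + ε / 2 := ENNReal.add_lt_add hUlt hbot
        _ = ε := ENNReal.add_halves ε

/-- From towers converging to the point partition one gets another such sequence, in which every
tower is approximately a stack of copies of the previous one, with prescribed total error. -/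
theorem exists_almost_nested_towers [SigmaFinite μ] (he : ∀ k : ℤ, MeasurePreserving (e ^ k) μ μ)
    {D : ℕ → Tower e} (hD : Converges μ D)
    (hsmall : ∀ ε : ENNReal, 0 < ε → ∀ᶠ m in atTop, 0 < μ (D m).base ∧ μ (D m).base < ε) :
    ∃ (t : ℕ → Tower e) (J : ℕ → Finset ℕ) (δ : ℕ → ENNReal), (t 0).height = 1 ∧
      μ (t 0).base ≠ ⊤ ∧ ∑' n, δ n < μ (t 0).base ∧ (∀ n, IsCopies (t n) (t (n + 1)) (J n)) ∧
      (∀ n, (t n).height * μ (symmDiff (t n).base ((t (n + 1)).union (J n))) ≤ δ n) ∧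
      Converges μ t := by
  obtain ⟨M, hM⟩ := eventually_atTop.1 (hsmall 1 one_pos)
  let t₀ : Tower e :=
    { base := (D M).base
      height := 1
      height_pos := one_pos
      measurableSet_base := (D M).measurableSet_base
      disjoint := fun i hi j hj hij => absurd (by omega : i = j) hij }
  have ht₀ : 0 < μ t₀.base ∧ μ t₀.base ≠ ⊤ := ⟨(hM M le_rfl).1, ne_top_of_lt (hM M le_rfl).2⟩
  obtain ⟨δ, hδ0, hδsum⟩ := ENNReal.exists_pos_sum_of_countable' ht₀.1.ne' ℕ
  have step : ∀ (n : ℕ) (t : {t : Tower e // 0 < μ t.base ∧ μ t.base ≠ ⊤}),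
      ∃ (t' : {t : Tower e // 0 < μ t.base ∧ μ t.base ≠ ⊤}) (J : Finset ℕ),
        IsCopies t.1 t'.1 J ∧ t.1.height * μ (symmDiff t.1.base (t'.1.union J)) ≤ δ n ∧
        ∀ i < (D (M + n)).height, ∃ U ⊆ Finset.range t'.1.height,
          μ (symmDiff (shift e i (D (M + n)).base) (t'.1.union U)) ≤
            δ n / (D (M + n)).height := by
    rintro n ⟨t, ht0, httop⟩
    -- The prescribed sets are the levels of `D (M + n)`. Dividing `δ n` by each height keeps the
    -- error summed over a whole tower at most `δ n`.
    obtain ⟨t', J, h1, h2, h3, h4, h5⟩ := exists_copies he hD hsmall t ht0 httop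
      (Finset.range (D (M + n)).height) (F := fun i : ℕ => shift e i (D (M + n)).base)
      (fun i _ => measurableSet_shift _ he (D (M + n)).measurableSet_base)
      (fun i _ => by
        rw [measure_shift _ _ he]
        exact ne_top_of_lt (hM (M + n) (by omega)).2)
      (ε := min (δ n / t.height) (δ n / (D (M + n)).height))
      (lt_min (ENNReal.div_pos (hδ0 n).ne' (by simp)) (ENNReal.div_pos (hδ0 n).ne' (by simp)))
    refine ⟨⟨t', h1, h2⟩, J, h3, ?_, fun i hi => ?_⟩
    · calc (t.height : ENNReal) * _ ≤ t.height * (δ n / t.height) := by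
            gcongr
            exact h4.le.trans (min_le_left _ _)
        _ ≤ δ n := ENNReal.mul_div_le
    · obtain ⟨U, hU, hUlt⟩ := h5 i (by simpa using hi)
      exact ⟨U, hU, hUlt.le.trans (min_le_right _ _)⟩
  choose next J hcopies hdiff happrox using step
  let t : ℕ → {t : Tower e // 0 < μ t.base ∧ μ t.base ≠ ⊤} :=
    fun n => Nat.rec ⟨t₀, ht₀⟩ next n
  refine ⟨fun n => (t n).1, fun n => J n (t n), δ, rfl, ht₀.2, hδsum,
    fun n => hcopies n (t n), fun n => hdiff n (t n), ?_⟩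
  intro A hA hAtop ε hε
  have hδT : Tendsto δ atTop (𝓝 0) := by
    rw [← Nat.cofinite_eq_atTop]
    exact ENNReal.tendsto_cofinite_zero_of_tsum_ne_top (ne_top_of_lt hδsum)
  have hε2 := ENNReal.half_pos hε.ne'
  have hev := (tendsto_atTop_mono (fun n => Nat.le_add_left n M) tendsto_id).eventually
    (hD A hA hAtop _ hε2)
  -- It is tower `n + 1` that approximates the levels of `D (M + n)`.
  rw [← map_add_atTop_eq_nat 1, eventually_map]
  filter_upwards [hev, hδT.eventually_lt_const hε2] with n ⟨S, hS, hlt⟩ hδn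
  choose! V hV hVle using happrox n (t n)
  have hSH : ∀ i ∈ S, i < (D (M + n)).height := fun i hi => by simpa using hS hi
  refine ⟨S.biUnion V, Finset.biUnion_subset.2 fun i hi => hV i (hSH i hi), ?_⟩
  have hsub : symmDiff A ((next n (t n)).1.union (S.biUnion V)) ⊆
      symmDiff A ((D (M + n)).union S) ∪
        ⋃ i ∈ S, symmDiff (shift e i (D (M + n)).base) ((next n (t n)).1.union (V i)) := by
    rintro x (⟨hx, hxV⟩ | ⟨hx, hxA⟩)
    · by_cases hxS : x ∈ (D (M + n)).union S
      · obtain ⟨i, hi, hxi⟩ := mem_union.1 hxS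
        refine Or.inr (Set.mem_biUnion hi (Or.inl ⟨hxi, fun h => hxV ?_⟩))
        exact union_mono _ (Finset.subset_biUnion_of_mem V hi) h
      · exact Or.inl (Or.inl ⟨hx, hxS⟩)
    · by_cases hxS : x ∈ (D (M + n)).union S
      · exact Or.inl (Or.inr ⟨hxS, hxA⟩)
      · obtain ⟨j, hj, hxj⟩ := mem_union.1 hx
        obtain ⟨i, hi, hji⟩ := Finset.mem_biUnion.1 hj
        exact Or.inr (Set.mem_biUnion hi (Or.inr ⟨mem_union.2 ⟨j, hji, hxj⟩,
          fun h => hxS (mem_union.2 ⟨i, hi, h⟩)⟩))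
  have hsum : ∑ i ∈ S, μ (symmDiff (shift e i (D (M + n)).base) ((next n (t n)).1.union (V i))) ≤
      δ n := by
    refine (Finset.sum_le_sum fun i hi => hVle i (hSH i hi)).trans ?_
    rw [Finset.sum_const, nsmul_eq_mul]
    have hcard : S.card ≤ (D (M + n)).height := by simpa using Finset.card_le_card hS
    calc (S.card : ENNReal) * (δ n / (D (M + n)).height)
        ≤ (D (M + n)).height * (δ n / (D (M + n)).height) := by gcongr
      _ ≤ δ n := ENNReal.mul_div_le
  calc μ (symmDiff A ((next n (t n)).1.union (S.biUnion V))) ≤ _ + _ :=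
        (measure_mono hsub).trans (measure_union_le _ _)
    _ ≤ μ (symmDiff A ((D (M + n)).union S)) + δ n := by
        gcongr
        exact (measure_biUnion_finset_le _ _).trans hsum
    _ < ε / 2 + ε / 2 := ENNReal.add_lt_add hlt hδn
    _ = ε := ENNReal.add_halves ε

end Tower

end InvertibleMPT

namespace InvertibleMPT

/-! ### Exact nesting by passage to the limit. -/

namespace Tower

variable {X : Type*} [MeasurableSpace X] {μ : Measure X} {e : Equiv.Perm X}

section Limit

variable (t : ℕ → Tower e) (J : ℕ → Finset ℕ)

/-- The base of the `n`-th tower rebuilt from the base of the `(n + d)`-th one. -/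
def rebuilt : ℕ → ℕ → Set X
  | 0, n => (t n).base
  | d + 1, n => ⋃ j ∈ J n, shift e j (rebuilt d (n + 1))

/-- The limit of the sets `rebuilt t J d n` as `d` tends to infinity. -/
def limitBase (n : ℕ) : Set X := liminf (fun d => rebuilt t J d n) atTop

variable {t J}

theorem mem_limitBase {n : ℕ} {x : X} :
    x ∈ limitBase t J n ↔ ∀ᶠ d in atTop, x ∈ rebuilt t J d n :=
  Filter.mem_liminf_iff_eventually_mem

theorem mem_rebuilt_succ {d n : ℕ} {x : X} : x ∈ rebuilt t J (d + 1) n ↔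
    ∃ j ∈ J n, x ∈ shift e j (rebuilt t J d (n + 1)) := by
  simp [rebuilt]

/-- Separation makes the position `i + p` in the next tower determine both the level `i` and the
copy `p`, so disjointness descends from stage `n + 1`. -/
theorem disjoint_rebuilt (hJ : ∀ n, IsCopies (t n) (t (n + 1)) (J n)) (d : ℕ) :
    ∀ n, ∀ i < (t n).height, ∀ j < (t n).height, i ≠ j →
      Disjoint (shift e i (rebuilt t J d n)) (shift e j (rebuilt t J d n)) := by
  induction d with
  | zero => exact fun n => (t n).disjoint
  | succ d ih =>
    intro n i hi j hj hij
    refine Set.disjoint_left.2 fun x hx hx' => ?_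
    rw [rebuilt, shift_iUnion] at hx hx'
    simp only [shift_iUnion, shift_shift, Set.mem_iUnion, exists_prop] at hx hx'
    obtain ⟨p, hp, hx⟩ := hx
    obtain ⟨q, hq, hx'⟩ := hx'
    have h1 := (hJ n).add_height_le p hp
    have h2 := (hJ n).add_height_le q hq
    have hne : i + p ≠ j + q := by
      rcases lt_trichotomy p q with h | h | h
      · have := (hJ n).separated p hp q hq h
        omega
      · omega
      · have := (hJ n).separated q hq p hp h
        omega
    have := ih (n + 1) (i + p) (by omega) (j + q) (by omega) hne
    push_cast at this
    exact Set.disjoint_left.1 this hx hx'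

theorem disjoint_limitBase (hJ : ∀ n, IsCopies (t n) (t (n + 1)) (J n)) (n : ℕ) :
    ∀ i < (t n).height, ∀ j < (t n).height, i ≠ j →
      Disjoint (shift e i (limitBase t J n)) (shift e j (limitBase t J n)) := by
  intro i hi j hj hij
  refine Set.disjoint_left.2 fun x hx hx' => ?_
  rw [mem_shift, mem_limitBase] at hx hx'
  obtain ⟨d, hd, hd'⟩ := (hx.and hx').exists
  exact Set.disjoint_left.1 (disjoint_rebuilt hJ d n i hi j hj hij) hd hd'

variable (he : ∀ k : ℤ, MeasurePreserving (e ^ k) μ μ)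

include he

theorem measurableSet_rebuilt (d : ℕ) : ∀ n, MeasurableSet (rebuilt t J d n) := by
  induction d with
  | zero => exact fun n => (t n).measurableSet_base
  | succ d ih =>
    exact fun n => (J n).measurableSet_biUnion fun j _ => measurableSet_shift _ he (ih (n + 1))

theorem measurableSet_limitBase (n : ℕ) : MeasurableSet (limitBase t J n) :=
  MeasurableSet.measurableSet_liminf fun d => measurableSet_rebuilt he d n

variable {δ : ℕ → ENNReal} (hJ : ∀ n, IsCopies (t n) (t (n + 1)) (J n))
  (hδ : ∀ n, (t n).height * μ (symmDiff (t n).base ((t (n + 1)).union (J n))) ≤ δ n)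

include hJ hδ

/-- A change at stage `n + 1` is repeated `(J n).card` times at stage `n`. As `(J n).card` copies of
height `(t n).height` fit in the next tower, weighting by the height absorbs this multiplicity. -/
theorem height_mul_measure_symmDiff_rebuilt_le (d : ℕ) : ∀ n,
    (t n).height * μ (symmDiff (rebuilt t J d n) (rebuilt t J (d + 1) n)) ≤ δ (n + d) := by
  induction d with
  | zero => exact hδ
  | succ d ih =>
    intro n
    have hsub : symmDiff (rebuilt t J (d + 1) n) (rebuilt t J (d + 2) n) ⊆
        ⋃ j ∈ J n, shift e j
          (symmDiff (rebuilt t J d (n + 1)) (rebuilt t J (d + 1) (n + 1))) := by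
      rintro x (⟨hx, hx'⟩ | ⟨hx, hx'⟩)
      all_goals
        rw [mem_rebuilt_succ] at hx hx'
        obtain ⟨j, hj, hx⟩ := hx
      · exact Set.mem_biUnion hj (Or.inl ⟨hx, fun h => hx' ⟨j, hj, h⟩⟩)
      · exact Set.mem_biUnion hj (Or.inr ⟨hx, fun h => hx' ⟨j, hj, h⟩⟩)
    have hle : μ (symmDiff (rebuilt t J (d + 1) n) (rebuilt t J (d + 2) n)) ≤
        (J n).card * μ (symmDiff (rebuilt t J d (n + 1)) (rebuilt t J (d + 1) (n + 1))) := by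
      refine (measure_mono hsub).trans ((measure_biUnion_finset_le _ _).trans ?_)
      simp [measure_shift _ _ he]
    have hcard : ((t n).height * (J n).card : ENNReal) ≤ (t (n + 1)).height := by
      rw [mul_comm]
      exact_mod_cast (hJ n).card_mul_height_le
    calc _ ≤ ((t n).height : ENNReal) * ((J n).card *
          μ (symmDiff (rebuilt t J d (n + 1)) (rebuilt t J (d + 1) (n + 1)))) := by gcongr
      _ ≤ (t (n + 1)).height *
          μ (symmDiff (rebuilt t J d (n + 1)) (rebuilt t J (d + 1) (n + 1))) := by
          rw [← mul_assoc]
          gcongr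
      _ ≤ _ := ih (n + 1)
      _ = δ (n + (d + 1)) := by ring_nf

theorem height_mul_measure_symmDiff_limitBase_le (n : ℕ) :
    (t n).height * μ (symmDiff (t n).base (limitBase t J n)) ≤ ∑' d, δ (d + n) := by
  -- A point whose membership never changes with `d` has the same status in the limit as in `(t
  -- n).base`.
  have hsub : symmDiff (t n).base (limitBase t J n) ⊆
      ⋃ d, symmDiff (rebuilt t J d n) (rebuilt t J (d + 1) n) := by
    intro x hx
    by_contra hcon
    have hall : ∀ d, (x ∈ rebuilt t J d n ↔ x ∈ (t n).base) := by
      intro d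
      induction d with
      | zero => rfl
      | succ d ih =>
        rw [← ih]
        by_contra hne
        refine hcon (Set.mem_iUnion.2 ⟨d, ?_⟩)
        rw [Set.mem_symmDiff]
        tauto
    have : x ∈ limitBase t J n ↔ x ∈ (t n).base := by
      rw [mem_limitBase, eventually_congr (Eventually.of_forall hall), eventually_const]
    rw [Set.mem_symmDiff] at hx
    tauto
  calc _ ≤ ((t n).height : ENNReal) *
        ∑' d, μ (symmDiff (rebuilt t J d n) (rebuilt t J (d + 1) n)) := by
        gcongr
        exact (measure_mono hsub).trans (measure_iUnion_le _)
    _ = ∑' d, (t n).height * μ (symmDiff (rebuilt t J d n) (rebuilt t J (d + 1) n)) :=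
        ENNReal.tsum_mul_left.symm
    _ ≤ ∑' d, δ (d + n) := ENNReal.tsum_le_tsum fun d => by
        rw [add_comm d n]
        exact height_mul_measure_symmDiff_rebuilt_le he hJ hδ d n

/-- By Borel–Cantelli, membership changes only finitely often almost everywhere. The lower limit is
thus a genuine limit, which lets it commute with the finite union over `J n`. -/
theorem ae_eventually_mem_rebuilt_or (hsum : ∑' n, δ n ≠ ⊤) (n : ℕ) : ∀ᵐ x ∂μ,
    (∀ᶠ d in atTop, x ∈ rebuilt t J d n) ∨ ∀ᶠ d in atTop, x ∉ rebuilt t J d n := by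
  have hfin : ∑' d, μ (symmDiff (rebuilt t J d n) (rebuilt t J (d + 1) n)) ≠ ⊤ := by
    refine ne_top_of_le_ne_top hsum ?_
    calc _ ≤ ∑' d, δ (n + d) := ENNReal.tsum_le_tsum fun d => by
          refine le_trans ?_ (height_mul_measure_symmDiff_rebuilt_le he hJ hδ d n)
          refine le_mul_of_one_le_left zero_le ?_
          exact_mod_cast (t n).height_pos
      _ ≤ _ := ENNReal.tsum_comp_le_tsum_of_injective (add_right_injective n) δ
  filter_upwards [ae_eventually_notMem hfin] with x hx
  obtain ⟨N, hN⟩ := eventually_atTop.1 hx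
  have hall : ∀ d ≥ N, (x ∈ rebuilt t J d n ↔ x ∈ rebuilt t J N n) := by
    intro d hd
    induction d, hd using Nat.le_induction with
    | base => rfl
    | succ d hd ih =>
      rw [← ih]
      have := hN d hd
      rw [Set.mem_symmDiff] at this
      tauto
  by_cases hx : x ∈ rebuilt t J N n
  · exact Or.inl (eventually_atTop.2 ⟨N, fun d hd => (hall d hd).2 hx⟩)
  · exact Or.inr (eventually_atTop.2 ⟨N, fun d hd h => hx ((hall d hd).1 h)⟩)

theorem limitBase_ae_eq (hsum : ∑' n, δ n ≠ ⊤) (n : ℕ) :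
    limitBase t J n =ᵐ[μ] ⋃ j ∈ J n, shift e j (limitBase t J (n + 1)) := by
  have h : ∀ᵐ x ∂μ, ∀ j : ℕ,
      (∀ᶠ d in atTop, x ∈ shift e j (rebuilt t J d (n + 1))) ∨
        ∀ᶠ d in atTop, x ∉ shift e j (rebuilt t J d (n + 1)) :=
    ae_all_iff.2 fun j => (he (-j)).quasiMeasurePreserving.ae
      (ae_eventually_mem_rebuilt_or he hJ hδ hsum (n + 1))
  filter_upwards [h] with x hx
  refine propext ?_
  change x ∈ limitBase t J n ↔ x ∈ ⋃ j ∈ J n, shift e j (limitBase t J (n + 1))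
  rw [mem_limitBase, ← map_add_atTop_eq_nat 1, eventually_map]
  simp only [mem_rebuilt_succ, Set.mem_iUnion, mem_shift, mem_limitBase, exists_prop] at hx ⊢
  constructor
  -- This inclusion needs the dichotomy: a point lying eventually in no fixed copy is, for large
  -- `d`, in none of the finitely many copies.
  · intro hev
    by_contra! hcon
    have : ∀ᶠ d in atTop, ∀ j ∈ J n, (e ^ (-(j : ℤ))) x ∉ rebuilt t J d (n + 1) :=
      (Finset.eventually_all (J n)).2 fun j hj => (hx j).resolve_left (by
        have := hcon j hj
        rwa [not_eventually])
    obtain ⟨d, ⟨j, hj, h1⟩, h2⟩ := (hev.and this).exists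
    exact h2 j hj h1
  · rintro ⟨j, hj, hev⟩
    exact hev.mono fun d hd => ⟨j, hj, hd⟩

end Limit

end Tower

/-- A separated set of positions comes from a sequence of spacer counts. -/
theorem exists_spacers {h H : ℕ} {J : Finset ℕ} (h0 : 0 ∈ J) (hle : ∀ j ∈ J, j + h ≤ H)
    (hsep : ∀ i ∈ J, ∀ j ∈ J, i < j → i + h ≤ j) :
    ∃ s : ℕ → ℕ, H = ∑ k ∈ Finset.range J.card, (h + s k) ∧
      (Finset.range J.card).image (fun i => ∑ k ∈ Finset.range i, (h + s k)) = J := by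
  -- `q` lists `J` in increasing order and takes the value `H` after its last element, so that the
  -- gap above the last copy also becomes a spacer count.
  let q : ℕ → ℕ := fun i => if hi : i < J.card then J.orderEmbOfFin rfl ⟨i, hi⟩ else H
  have hqJ : ∀ i < J.card, q i ∈ J := by
    intro i hi
    simp only [q, hi, dif_pos]
    exact J.orderEmbOfFin_mem rfl _
  have hcard : 0 < J.card := Finset.card_pos.2 ⟨0, h0⟩
  have hq0 : q 0 = 0 := by
    simp only [q, hcard, dif_pos]
    rw [Finset.orderEmbOfFin_zero rfl hcard]
    exact Nat.le_zero.1 (J.min'_le 0 h0)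
  have hstep : ∀ i < J.card, q i + h ≤ q (i + 1) := by
    intro i hi
    by_cases hi' : i + 1 < J.card
    · refine hsep _ (hqJ i hi) _ (hqJ _ hi') ?_
      simp only [q, hi, hi', dif_pos]
      exact (J.orderEmbOfFin rfl).strictMono (by simp)
    · simp only [q, hi', dif_neg, not_false_eq_true]
      exact hle _ (hqJ i hi)
  have hsum : ∀ i ≤ J.card, ∑ k ∈ Finset.range i, (h + (q (k + 1) - q k - h)) = q i := by
    intro i
    induction i with
    | zero => simp [hq0]
    | succ i ih =>
      intro hi
      rw [Finset.sum_range_succ, ih (by omega)]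
      have := hstep i (by omega)
      omega
  refine ⟨fun k => q (k + 1) - q k - h, ?_, ?_⟩
  · rw [hsum _ le_rfl]
    simp [q]
  · ext x
    rw [Finset.mem_image]
    constructor
    · rintro ⟨i, hi, rfl⟩
      rw [Finset.mem_range] at hi
      rw [hsum i hi.le]
      exact hqJ i hi
    · intro hx
      have : x ∈ Set.range (J.orderEmbOfFin rfl) := by
        rw [Finset.range_orderEmbOfFin]
        exact hx
      obtain ⟨i, rfl⟩ := this
      refine ⟨i, by simp, ?_⟩
      rw [hsum i i.2.le]
      simp [q]

/-! ### Existence of a presentation. -/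

section Existence

variable {X : Type*} [MeasurableSpace X] {μ : Measure X} {T : InvertibleMPT μ}
  {e : Equiv.Perm X} (he : ∀ k : ℤ, MeasurePreserving (e ^ k) μ μ)
  (hTe : ∀ (k : ℕ) (B : Set X), T.iterImage k B =ᵐ[μ] shift e k B)

include he hTe

/-- Removing a null set makes the levels of a column disjoint. -/
theorem Column.exists_tower (C : T.Column) :
    ∃ t : Tower e, t.height = C.height ∧ t.base =ᵐ[μ] C.base := by
  have hnull : ∀ k : ℕ, 0 < k → k < C.height → μ (C.base ∩ shift e k C.base) = 0 := by
    intro k hk hkh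
    have := C.aedisjoint_shift hTe 0 C.height_pos k hkh hk.ne
    simpa [AEDisjoint] using this
  refine ⟨
    { base := C.base \ ⋃ k ∈ Finset.Ico 1 C.height, shift e k C.base
      height := C.height
      height_pos := C.height_pos
      measurableSet_base := C.measurableSet_base.diff (Finset.measurableSet_biUnion _
        fun k _ => measurableSet_shift _ he C.measurableSet_base)
      disjoint := ?_ }, rfl, ?_⟩
  · intro i hi j hj hij
    wlog hlt : i < j generalizing i j
    · exact (this j hj i hi hij.symm (by omega)).symm
    refine Set.disjoint_left.2 ?_
    rintro x ⟨-, hx⟩ ⟨hx', -⟩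
    refine hx (Set.mem_biUnion (x := j - i) (by simp; omega) ?_)
    rw [← mem_shift, shift_shift, Nat.cast_sub hlt.le, add_sub_cancel]
    exact hx'
  · refine (ae_eq_set).2 ⟨?_, ?_⟩
    · rw [Set.sdiff_eq_empty.2 Set.sdiff_subset, measure_empty]
    · rw [Set.sdiff_sdiff_right_self, Set.inter_iUnion₂]
      refine (measure_biUnion_null_iff (Finset.countable_toSet _)).2 fun k hk => ?_
      have := Finset.mem_Ico.1 hk
      exact hnull k (by omega) (by omega)

theorem IsRankOne.exists_towers (hT : T.IsRankOne) :
    ∃ D : ℕ → Tower e, Tower.Converges μ D := by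
  obtain ⟨C, hC⟩ := hT
  choose D hh hb using fun n => (C n).exists_tower he hTe
  refine ⟨D, fun A hA hAtop ε hε => ?_⟩
  obtain ⟨N, hN⟩ := hC A hA hAtop ε hε
  refine eventually_atTop.2 ⟨N, fun n hn => ?_⟩
  obtain ⟨S, hS, hlt⟩ := hN n hn
  refine ⟨S, by rwa [hh], lt_of_eq_of_lt ?_ hlt⟩
  refine measure_congr (EventuallyEq.rfl.symmDiff (biUnion_ae_eq S fun i => ?_))
  exact (shift_ae_eq (i : ℤ) he (hb n)).trans (hTe i _).symm

/-- Every rank-one transformation has a cutting and stacking presentation. -/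
theorem IsRankOne.exists_isCuttingAndStacking [SigmaFinite μ]
    (hμ : ∀ δ : ENNReal, 0 < δ → ∃ A, MeasurableSet A ∧ 0 < μ A ∧ μ A < δ) (hT : T.IsRankOne) :
    ∃ (C : ℕ → T.Column) (r : ℕ → ℕ) (s : ℕ → ℕ → ℕ), IsCuttingAndStacking C r s := by
  obtain ⟨D, hD⟩ := hT.exists_towers he hTe
  obtain ⟨t, J, δ, ht0, httop, hδsum, hJ, hδ, ht⟩ := Tower.exists_almost_nested_towers he hD
    fun ε hε => Tower.eventually_measure_base he hD hμ hε
  have hsum : ∑' n, δ n ≠ ⊤ := ne_top_of_lt hδsum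
  set B := Tower.limitBase t J with hB
  have hBm : ∀ n, MeasurableSet (B n) := Tower.measurableSet_limitBase he
  have hclose := Tower.height_mul_measure_symmDiff_limitBase_le he hJ hδ
  let C : ℕ → T.Column := fun n =>
    { base := B n
      height := (t n).height
      height_pos := (t n).height_pos
      measurableSet_base := hBm n
      aedisjoint := fun i hi j hj hij =>
        (Tower.disjoint_limitBase hJ n i hi j hj hij).aedisjoint.congr (hTe i _) (hTe j _) }
  choose s hs hsJ using fun n =>
    exists_spacers (hJ n).zero_mem (hJ n).add_height_le (hJ n).separated
  -- The total error was chosen below the measure of the initial base, so the limit base cannot be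
  -- null.
  have hclose0 : μ (symmDiff (t 0).base (B 0)) < μ (t 0).base := by
    have := hclose 0
    rw [ht0, Nat.cast_one, one_mul] at this
    exact this.trans_lt hδsum
  refine ⟨C, fun n => (J n).card, s, ht0, ?_, ?_, fun n => (hJ n).two_le_card, hs, ?_, ?_⟩
  · refine pos_iff_ne_zero.2 fun h0 => hclose0.not_ge ?_
    change μ (B 0) = 0 at h0
    have h1 : (t 0).base ⊆ symmDiff (t 0).base (B 0) ∪ B 0 := by
      intro x hx
      by_cases hxB : x ∈ B 0
      · exact Or.inr hxB
      · exact Or.inl (Or.inl ⟨hx, hxB⟩)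
    have h2 := (measure_mono (μ := μ) h1).trans (measure_union_le _ _)
    rwa [h0, add_zero] at h2
  · have h1 : B 0 ⊆ symmDiff (t 0).base (B 0) ∪ (t 0).base := by
      intro x hx
      by_cases hxB : x ∈ (t 0).base
      · exact Or.inr hxB
      · exact Or.inl (Or.inr ⟨hx, hxB⟩)
    exact ne_top_of_le_ne_top (ENNReal.add_ne_top.2 ⟨ne_top_of_lt hclose0, httop⟩)
      ((measure_mono h1).trans (measure_union_le _ _))
  · intro n
    refine (Tower.limitBase_ae_eq he hJ hδ hsum n).trans ?_
    have h1 : (⋃ j ∈ J n, shift e j (B (n + 1)) : Set X) =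
        ⋃ i ∈ Finset.range (J n).card,
          shift e (∑ k ∈ Finset.range i, ((t n).height + s n k) : ℕ) (B (n + 1)) := by
      conv_lhs => rw [← hsJ n]
      rw [Finset.set_biUnion_finset_image]
    rw [h1]
    exact biUnion_ae_eq _ fun i => (hTe _ _).symm
  · intro A hA hAtop ε hε
    have hε2 := ENNReal.half_pos hε.ne'
    have htail : ∀ᶠ n in atTop, ∑' d, δ (d + n) < ε / 2 :=
      (ENNReal.tendsto_sum_nat_add δ hsum).eventually_lt_const hε2
    obtain ⟨N, hN⟩ := eventually_atTop.1 ((ht A hA hAtop _ hε2).and htail)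
    refine ⟨N, fun n hn => ?_⟩
    obtain ⟨⟨S, hS, hlt⟩, htail⟩ := hN n hn
    refine ⟨S, hS, ?_⟩
    have h1 : μ (symmDiff A (⋃ i ∈ S, (C n).level i)) =
        μ (symmDiff A (⋃ i ∈ S, shift e i (B n))) :=
      measure_congr (EventuallyEq.rfl.symmDiff (biUnion_ae_eq S fun i => hTe i _))
    -- Replacing `(t n).base` by `B n` in all the levels costs at most the height times the change
    -- of base, which is bounded by a tail of `∑ δ`.
    have hsub : symmDiff A (⋃ i ∈ S, shift e i (B n)) ⊆ symmDiff A ((t n).union S) ∪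
        ⋃ i ∈ S, shift e i (symmDiff (t n).base (B n)) := by
      refine (symmDiff_triangle A ((t n).union S) _).trans (Set.union_subset_union_right _ ?_)
      rintro x (⟨hx, hx'⟩ | ⟨hx, hx'⟩) <;> obtain ⟨i, hi, hx⟩ := Set.mem_iUnion₂.1 hx
      · exact Set.mem_biUnion hi (Or.inl ⟨hx, fun h => hx' (Set.mem_biUnion hi h)⟩)
      · exact Set.mem_biUnion hi (Or.inr ⟨hx, fun h => hx' (Set.mem_biUnion hi h)⟩)
    have hcard : (S.card : ENNReal) ≤ (t n).height := by
      exact_mod_cast (by simpa using Finset.card_le_card hS : S.card ≤ (t n).height)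
    rw [h1]
    calc _ ≤ μ (symmDiff A ((t n).union S)) +
          ∑ i ∈ S, μ (shift e (i : ℤ) (symmDiff (t n).base (B n))) :=
        (measure_mono hsub).trans ((measure_union_le _ _).trans
          (add_le_add le_rfl (measure_biUnion_finset_le _ _)))
      _ ≤ μ (symmDiff A ((t n).union S)) +
          (t n).height * μ (symmDiff (t n).base (B n)) := by
          simp only [measure_shift _ _ he, Finset.sum_const, nsmul_eq_mul]
          gcongr
      _ < ε / 2 + ε / 2 := ENNReal.add_lt_add hlt ((hclose n).trans_lt htail)
      _ = ε := ENNReal.add_halves ε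

end Existence

end InvertibleMPT

theorem mainTheorem5 {X : Type*} [MeasurableSpace X] [StandardBorelSpace X]
    (μ : Measure X) [SigmaFinite μ] [NullSingletonClass μ] (hμ : μ ≠ 0)
    (T : InvertibleMPT μ) (hT : T.IsRankOne) :
    (∃ (C : ℕ → T.Column) (r : ℕ → ℕ) (s : ℕ → ℕ → ℕ),
      InvertibleMPT.IsCuttingAndStacking C r s) ∧
    ∀ (C : ℕ → T.Column) (r : ℕ → ℕ) (s : ℕ → ℕ → ℕ),
      InvertibleMPT.IsCuttingAndStacking C r s →
      ∀ A B : Set X, InvertibleMPT.IsFiniteUnionOfLevels C A →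
        InvertibleMPT.IsFiniteUnionOfLevels C B →
        T.WeakRationalLimit ((C 0).level 0) A B := by
  obtain ⟨e, he, hTe⟩ := InvertibleMPT.exists_perm T
  exact ⟨hT.exists_isCuttingAndStacking he hTe fun δ hδ => exists_measure_pos_lt μ hμ hδ,
    fun C r s hC A B hA hB => hC.weakRationalLimit he hTe hA hB⟩
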